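/- Let $k$ be a field and let $(Q,I)$ be a bound quiver: $Q$ is a finite quiver and $I$ is an admissible two-sided ideal of the path algebra $kQ$, that is, $F^m\subseteq I\subseteq F^2$ for some $m\ge 2$, where $F$ is the ideal generated by the arrows. Paths are composed from left to right, and $e_x$ denotes the stationary path at the vertex $x$. Call a relation $\sum_{i=1}^m\lambda_i w_i\in I$ (with $\lambda_i\in k\setminus\{0\}$ and $w_1,\dots,w_m$ distinct parallel paths) minimal if $m\ge2$ and $\sum_{i\in J}\lambda_iw_i\notin I$ for every nonempty proper subset $J\subset\{1,\dots,m\}$. Natural homotopy is the equivalence relation on parallel paths generated by $uvw\sim uv'w$ for paths $u,v,v',w$ with $v,v'$ appearing in the same minimal relation; $[\sigma]$ denotes the class of a path $\sigma$. The classifying space $\mathcal B(Q,I)$ is the CW-complex whose $0$-cells are the vertices of $Q$ and whose $n$-cells, $n\ge1$, are the tuples $([\sigma_1],\dots,[\sigma_n])$ for which the representatives can be chosen non-stationary, composable and such that $\sigma_1\cdots\sigma_n\notin I$. It is obtained by taking one standard simplex $\Delta^n$ for each $n$-cell and gluing, for each $i$, the face $\{t_i=0\}$ of the simplex of a cell to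 the simplex of its $i$-th face: the $0$-th face omits $[\sigma_1]$, the $n$-th face omits $[\sigma_n]$, and for $0<i<n$ the $i$-th face replaces $[\sigma_i],[\sigma_{i+1}]$ by $[\sigma_i\sigma_{i+1}]$; for $n=1$ the $0$-th face is the target of $\sigma_1$ and the first face is its source. Let $\overline Q$ be the underlying graph of $Q$, as a topological space (one point for each vertex and one closed edge for each arrow). It maps canonically to $\mathcal B(Q,I)$, a vertex going to the corresponding $0$-cell and the edge of an arrow $\alpha$ to the $1$-cell $[\alpha]$. **Proposition 3.1.** Suppose that $I$ is monomial (generated by a set of paths) and that $A=kQ/I$ is almost triangular: for all vertices $x,y$ of $Q$, if $e_x(\operatorname{rad}A)e_y\ne0$ then $e_y(\operatorname{rad}A)e_x=0$. Then the canonical map $\overline Q\to\mathcal B(Q,I)$ is a homeomorphism onto its image, and this image is a strong deformation retract of $\mathcal B(Q,I)$: there is a continuous map $H:\mathcal B(Q,I)\times[0,1]\to\mathcal B(Q,I)$ with $H(b,0)=b$ and $H(b,1)\in\overline Q$ for all $b\in\mathcal B(Q,I)$, and $H(q,t)=q$ for all $q\in\overline Q$ and $t\in[0,1]$. -/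

import Mathlib

open CategoryTheory Topology

universe u v w

noncomputable section

/-! ## The path algebra of a finite quiver -/

/-- The paths of a quiver, of all sources and targets, stationary paths included. -/
abbrev QuiverPath (V : Type u) [Quiver.{v + 1} V] := Σ x y : V, Quiver.Path x y

/-- The path algebra `kQ`: the `k`-vector space with basis the paths of `Q`. -/
def PathAlgebra (k : Type w) (V : Type u) [Field k] [Quiver.{v + 1} V] :=
  QuiverPath V →₀ k

namespace PathAlgebra

section

variable {k : Type w} {V : Type u} [Field k] [Quiver.{v + 1} V]

instance : AddCommGroup (PathAlgebra k V) :=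
  inferInstanceAs (AddCommGroup (QuiverPath V →₀ k))

instance : Module k (PathAlgebra k V) :=
  inferInstanceAs (Module k (QuiverPath V →₀ k))

/-- The basis element of `kQ` given by a path. -/
def single (p : QuiverPath V) : PathAlgebra k V := Finsupp.single p (1 : k)

/-- The basis element of `kQ` given by a path from `x` to `y`. -/
def path {x y : V} (p : Quiver.Path x y) : PathAlgebra k V := single ⟨x, y, p⟩

variable (k) in
/-- The element of `kQ` given by the stationary path `e_x`. -/
def idem (x : V) : PathAlgebra k V := path (Quiver.Path.nil : Quiver.Path x x)

open Classical in
/-- Product of two basis elements: their composition (`p` first, then `q`) if the target of `p`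
is the source of `q`, and `0` otherwise. -/
def mulPath (p q : QuiverPath V) : PathAlgebra k V :=
  if h : p.2.1 = q.1 then path (p.2.2.comp (q.2.2.cast h.symm rfl)) else 0

/-- The bilinear extension of the product of paths. -/
def mulLin : (QuiverPath V →₀ k) →ₗ[k] (QuiverPath V →₀ k) →ₗ[k] PathAlgebra k V :=
  Finsupp.lift ((QuiverPath V →₀ k) →ₗ[k] PathAlgebra k V) k (QuiverPath V) fun p =>
    Finsupp.lift (PathAlgebra k V) k (QuiverPath V) fun q => mulPath p q

instance : Mul (PathAlgebra k V) := ⟨fun f g => mulLin f g⟩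

instance [Fintype V] : One (PathAlgebra k V) := ⟨∑ x : V, idem k x⟩

theorem one_def [Fintype V] : (1 : PathAlgebra k V) = ∑ x : V, idem k x := rfl

theorem single_mul_single (p q : QuiverPath V) :
    (single p * single q : PathAlgebra k V) = mulPath p q := by
  change mulLin (Finsupp.single p 1) (Finsupp.single q 1) = mulPath p q
  simp [mulLin]

theorem path_mul_path {x y z : V} (p : Quiver.Path x y) (q : Quiver.Path y z) :
    (path p * path q : PathAlgebra k V) = path (p.comp q) := by
  unfold path
  rw [single_mul_single]
  simp [mulPath, path]

theorem path_mul_path_of_ne {x y y' z : V} (h : y ≠ y') (p : Quiver.Path x y)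
    (q : Quiver.Path y' z) : (path p * path q : PathAlgebra k V) = 0 := by
  unfold path
  rw [single_mul_single]
  simp [mulPath, h]

theorem induction_on {P : PathAlgebra k V → Prop} (f : PathAlgebra k V) (h0 : P 0)
    (hadd : ∀ f g, P f → P g → P (f + g))
    (hpath : ∀ (c : k) {x y : V} (p : Quiver.Path x y), P (c • path p)) : P f := by
  refine Finsupp.induction_linear (motive := P) f h0 hadd ?_
  rintro ⟨x, y, p⟩ c
  have := hpath c p
  unfold path single at this
  erw [Finsupp.smul_single_one] at this
  exact this

protected theorem add_mul (f g h : PathAlgebra k V) : (f + g) * h = f * h + g * h :=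
  mulLin.map_add₂ f g h

protected theorem mul_add (f g h : PathAlgebra k V) : f * (g + h) = f * g + f * h :=
  (mulLin f).map_add g h

protected theorem smul_mul (c : k) (f g : PathAlgebra k V) : (c • f) * g = c • (f * g) :=
  mulLin.map_smul₂ c f g

protected theorem mul_smul (c : k) (f g : PathAlgebra k V) : f * (c • g) = c • (f * g) :=
  (mulLin f).map_smul c g

protected theorem zero_mul (f : PathAlgebra k V) : 0 * f = 0 := mulLin.map_zero₂ f

protected theorem mul_zero (f : PathAlgebra k V) : f * 0 = 0 := (mulLin f).map_zero

protected theorem sum_mul {ι : Type*} (s : Finset ι) (f : ι → PathAlgebra k V)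
    (g : PathAlgebra k V) : (∑ i ∈ s, f i) * g = ∑ i ∈ s, f i * g :=
  mulLin.map_sum₂ s f g

protected theorem mul_sum {ι : Type*} (s : Finset ι) (f : PathAlgebra k V)
    (g : ι → PathAlgebra k V) : f * (∑ i ∈ s, g i) = ∑ i ∈ s, f * g i :=
  map_sum (mulLin f) g s

theorem path_assoc {x y x' y' x'' y'' : V} (p : Quiver.Path x y)
    (q : Quiver.Path x' y') (r : Quiver.Path x'' y'') :
    (path p * path q * path r : PathAlgebra k V) = path p * (path q * path r) := by
  by_cases h : y = x'
  · subst h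
    by_cases h' : y' = x''
    · subst h'
      simp only [path_mul_path, Quiver.Path.comp_assoc]
    · rw [path_mul_path, path_mul_path_of_ne h', path_mul_path_of_ne h', PathAlgebra.mul_zero]
  · by_cases h' : y' = x''
    · subst h'
      rw [path_mul_path, path_mul_path_of_ne h, path_mul_path_of_ne h, PathAlgebra.zero_mul]
    · rw [path_mul_path_of_ne h', path_mul_path_of_ne h, PathAlgebra.zero_mul, PathAlgebra.mul_zero]

protected theorem mul_assoc (f g h : PathAlgebra k V) : f * g * h = f * (g * h) := by
  induction f using induction_on with
  | h0 => simp only [PathAlgebra.zero_mul]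
  | hadd f f' hf hf' => simp only [PathAlgebra.add_mul, hf, hf']
  | hpath c p =>
    induction g using induction_on with
    | h0 => simp only [PathAlgebra.zero_mul, PathAlgebra.mul_zero]
    | hadd g g' hg hg' => simp only [PathAlgebra.add_mul, PathAlgebra.mul_add, hg, hg']
    | hpath d q =>
      induction h using induction_on with
      | h0 => simp only [PathAlgebra.mul_zero]
      | hadd h h' hh hh' => simp only [PathAlgebra.mul_add, hh, hh']
      | hpath e r => simp only [PathAlgebra.smul_mul, PathAlgebra.mul_smul, path_assoc]

protected theorem one_mul [Fintype V] (f : PathAlgebra k V) : 1 * f = f := by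
  induction f using induction_on with
  | h0 => exact PathAlgebra.mul_zero _
  | hadd f g hf hg => rw [PathAlgebra.mul_add, hf, hg]
  | @hpath c x y p =>
    rw [PathAlgebra.mul_smul, one_def, PathAlgebra.sum_mul, Finset.sum_eq_single x]
    · rw [idem, path_mul_path, Quiver.Path.nil_comp]
    · intro z _ hz
      rw [idem, path_mul_path_of_ne hz]
    · simp

protected theorem mul_one [Fintype V] (f : PathAlgebra k V) : f * 1 = f := by
  induction f using induction_on with
  | h0 => exact PathAlgebra.zero_mul _
  | hadd f g hf hg => rw [PathAlgebra.add_mul, hf, hg]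
  | @hpath c x y p =>
    rw [PathAlgebra.smul_mul, one_def, PathAlgebra.mul_sum, Finset.sum_eq_single y]
    · rw [idem, path_mul_path, Quiver.Path.comp_nil]
    · intro z _ hz
      rw [idem, path_mul_path_of_ne (Ne.symm hz)]
    · simp

instance [Fintype V] : Ring (PathAlgebra k V) :=
  { (inferInstance : AddCommGroup (PathAlgebra k V)) with
    left_distrib := PathAlgebra.mul_add
    right_distrib := PathAlgebra.add_mul
    zero_mul := PathAlgebra.zero_mul
    mul_zero := PathAlgebra.mul_zero
    mul_assoc := PathAlgebra.mul_assoc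
    one_mul := PathAlgebra.one_mul
    mul_one := PathAlgebra.mul_one }

instance [Fintype V] : Algebra k (PathAlgebra k V) :=
  Algebra.ofModule PathAlgebra.smul_mul PathAlgebra.mul_smul

end

end PathAlgebra

/-! ## Bound quivers -/

namespace BoundQuiver

open PathAlgebra

section

variable {k : Type w} {V : Type u} [Field k] [Quiver.{v + 1} V]

/-- The length of a path, seen as a morphism of the path category. -/
def homLength {x y : Paths V} (f : x ⟶ y) : ℕ := Quiver.Path.length (V := V) f

/-- The element of `kQ` given by a path, seen as a morphism of the path category. -/
def homElt (k : Type w) [Field k] {x y : Paths V} (f : x ⟶ y) : PathAlgebra k V :=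
  path (V := V) (x := x) (y := y) f

theorem homLength_comp {x y z : Paths V} (f : x ⟶ y) (g : y ⟶ z) :
    homLength (f ≫ g) = homLength f + homLength g :=
  Quiver.Path.length_comp (V := V) f g

theorem homElt_comp {x y z : Paths V} (f : x ⟶ y) (g : y ⟶ z) :
    homElt k (f ≫ g) = homElt k f * homElt k g :=
  (path_mul_path (V := V) (x := x) (y := y) (z := z) f g).symm

/-- Linear combinations of paths of length at least `m`. -/
def longPaths (k : Type w) (V : Type u) [Field k] [Quiver.{v + 1} V] (m : ℕ) :
    Submodule k (PathAlgebra k V) :=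
  Submodule.span k {f | ∃ (x y : V) (p : Quiver.Path x y), m ≤ p.length ∧ f = path p}

theorem mem_longPaths_zero (f : PathAlgebra k V) : f ∈ longPaths k V 0 := by
  induction f using PathAlgebra.induction_on with
  | h0 => exact zero_mem _
  | hadd f g hf hg => exact add_mem hf hg
  | hpath c p => exact Submodule.smul_mem _ _ (Submodule.subset_span ⟨_, _, p, Nat.zero_le _, rfl⟩)

variable [Fintype V]

variable (k V) in
/-- The two-sided ideal `F` of `kQ` generated by the arrows. -/
def arrowIdeal : TwoSidedIdeal (PathAlgebra k V) :=
  TwoSidedIdeal.span {f | ∃ (x y : V) (a : x ⟶ y), f = path a.toPath}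

/-- `I` is admissible: `F ^ m ⊆ I ⊆ F ^ 2` for some `m ≥ 2`. -/
def IsAdmissible (I : TwoSidedIdeal (PathAlgebra k V)) : Prop :=
  ∃ m : ℕ, 2 ≤ m ∧ (arrowIdeal k V).asIdeal ^ m ≤ I.asIdeal ∧
    I.asIdeal ≤ (arrowIdeal k V).asIdeal ^ 2

/-- `I` is monomial: it is generated, as a two-sided ideal, by a set of paths. -/
def IsMonomial (I : TwoSidedIdeal (PathAlgebra k V)) : Prop :=
  ∃ S : Set (QuiverPath V), I = TwoSidedIdeal.span (single '' S)

/-- The bound quiver algebra `A = kQ / I`. -/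
abbrev Alg (I : TwoSidedIdeal (PathAlgebra k V)) := I.ringCon.Quotient

/-- `A = kQ / I` is almost triangular: for all vertices `x`, `y`, if `e_x (rad A) e_y ≠ 0` then
`e_y (rad A) e_x = 0`, where `rad A` is the Jacobson radical. -/
def IsAlmostTriangular (I : TwoSidedIdeal (PathAlgebra k V)) : Prop :=
  ∀ x y : V,
    (∃ r ∈ Ring.jacobson (Alg I), (idem k x : Alg I) * r * (idem k y : Alg I) ≠ 0) →
      ∀ r ∈ Ring.jacobson (Alg I), (idem k y : Alg I) * r * (idem k x : Alg I) = 0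

/-! ## Natural homotopy -/

/-- `∑ w, ρ w • w`, a linear combination of paths from `x` to `y`, is a minimal relation: it lies
in `I`, it involves at least two paths, and no sum over a nonempty proper subset of the paths
involved lies in `I`. -/
def IsMinimalRelation (I : TwoSidedIdeal (PathAlgebra k V)) {x y : V}
    (ρ : Quiver.Path x y →₀ k) : Prop :=
  2 ≤ ρ.support.card ∧ (∑ w ∈ ρ.support, ρ w • path w) ∈ I ∧
    ∀ J, J ⊂ ρ.support → J.Nonempty → (∑ w ∈ J, ρ w • path w) ∉ I

/-- Two parallel paths appear in the same minimal relation. -/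
def MinRel (I : TwoSidedIdeal (PathAlgebra k V)) : HomRel (Paths V) := fun x y p q =>
  ∃ ρ : Quiver.Path (V := V) x y →₀ k, IsMinimalRelation I ρ ∧ p ∈ ρ.support ∧ q ∈ ρ.support

/-- The category `P(Q, I)`: the path category of `Q` modulo natural homotopy. The morphisms from
`x` to `y` are the natural homotopy classes of paths from `x` to `y`, that is, the classes for the
equivalence relation generated by `u v w ∼ u v' w` with `v`, `v'` in the same minimal relation. -/
abbrev NatPaths (I : TwoSidedIdeal (PathAlgebra k V)) := CategoryTheory.Quotient (MinRel I)

/-- The functor sending a path to its natural homotopy class. -/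
abbrev natClass (I : TwoSidedIdeal (PathAlgebra k V)) : Paths V ⥤ NatPaths I :=
  CategoryTheory.Quotient.functor (MinRel I)

/-! ## The classifying space -/

/-- A sequence `(σ₁, …, σₙ)` of composable paths is good if no `σᵢ` is stationary and
`σ₁ ⋯ σₙ ∉ I`. (For `n = 0` the sequence is a vertex `x` and the composition is `e_x`.) -/
def IsGood (I : TwoSidedIdeal (PathAlgebra k V)) {n : ℕ} (G : ComposableArrows (Paths V) n) :
    Prop :=
  (∀ i : Fin n, homLength (G.map (homOfLE i.castSucc_le_succ)) ≠ 0) ∧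
    homElt k (G.map (homOfLE (Fin.zero_le (Fin.last n)))) ∉ I

/-- The set `C_n` of `n`-cells: the sequences of natural homotopy classes of the good sequences
`(σ₁, …, σₙ)` of composable paths. -/
def Cell (I : TwoSidedIdeal (PathAlgebra k V)) (n : ℕ) :=
  {F : ComposableArrows (NatPaths I) n //
    ∃ G : ComposableArrows (Paths V) n, IsGood I G ∧ G ⋙ natClass I = F}

theorem length_ne_zero_of_lt {I : TwoSidedIdeal (PathAlgebra k V)} {n : ℕ}
    {G : ComposableArrows (Paths V) n} (hG : IsGood I G) {i j : Fin (n + 1)} (h : i < j) :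
    homLength (G.map (homOfLE h.le)) ≠ 0 := by
  have hi : (i : ℕ) < n := by omega
  have hj : (⟨i, hi⟩ : Fin n).succ ≤ j := by
    rw [Fin.le_def]; simpa using h
  have e : G.map (homOfLE h.le) =
      G.map (homOfLE (Fin.castSucc_le_succ (⟨i, hi⟩ : Fin n))) ≫ G.map (homOfLE hj) := by
    rw [← G.map_comp]; rfl
  rw [e, homLength_comp]
  have := hG.1 ⟨i, hi⟩
  omega

/-- The functor `Fin (n + 1) ⥤ Fin (n + 2)` that skips `i`. -/
abbrev skip {n : ℕ} (i : Fin (n + 2)) : Fin (n + 1) ⥤ Fin (n + 2) :=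
  (Fin.strictMono_succAbove i).monotone.functor

theorem IsGood.skip {I : TwoSidedIdeal (PathAlgebra k V)} {n : ℕ}
    {G : ComposableArrows (Paths V) (n + 1)} (hG : IsGood I G) (i : Fin (n + 2)) :
    IsGood I (G.whiskerLeft (skip i)) := by
  refine ⟨fun j => ?_, fun h => hG.2 ?_⟩
  · exact length_ne_zero_of_lt hG (Fin.strictMono_succAbove i (Fin.castSucc_lt_succ (i := j)))
  · have e : G.map (homOfLE (Fin.zero_le (Fin.last (n + 1)))) =
        G.map (homOfLE (Fin.zero_le (i.succAbove 0))) ≫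
          G.map (homOfLE ((Fin.strictMono_succAbove i).monotone (Fin.zero_le (Fin.last n)))) ≫
            G.map (homOfLE (Fin.le_last (i.succAbove (Fin.last n)))) := by
      rw [← G.map_comp, ← G.map_comp]; rfl
    rw [e, homElt_comp, homElt_comp]
    exact I.mul_mem_left _ _ (I.mul_mem_right _ _ h)

/-- The face map `∂_i : C_{n+1} → C_n`: it deletes the `i`-th vertex, that is, it omits the first
class for `i = 0`, the last one for `i = n + 1`, and otherwise composes the `i`-th and the
`(i + 1)`-st. -/
def Cell.face {I : TwoSidedIdeal (PathAlgebra k V)} {n : ℕ} (i : Fin (n + 2))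
    (σ : Cell I (n + 1)) : Cell I n :=
  ⟨σ.1.whiskerLeft (skip i), by
    obtain ⟨G, hG, e⟩ := σ.2
    exact ⟨G.whiskerLeft (BoundQuiver.skip i), hG.skip i, by rw [← e]; rfl⟩⟩

/-- The standard `n`-simplex. -/
abbrev Simplex (n : ℕ) := stdSimplex ℝ (Fin (n + 1))

/-- The inclusion of the `i`-th face `{t_i = 0}` of the standard `(n + 1)`-simplex. -/
def faceIncl {n : ℕ} (i : Fin (n + 2)) : Simplex n → Simplex (n + 1) :=
  stdSimplex.map i.succAbove

/-- The disjoint union of one copy of the standard `n`-simplex for each `n`-cell, over all `n`. -/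
abbrev Simplices (I : TwoSidedIdeal (PathAlgebra k V)) :=
  Σ c : (Σ n, Cell I n), Simplex c.1

/-- The `i`-th face of the simplex of `σ` is glued to the simplex of `∂_i σ`. -/
inductive Glue (I : TwoSidedIdeal (PathAlgebra k V)) : Simplices I → Simplices I → Prop
  | face {n : ℕ} (σ : Cell I (n + 1)) (i : Fin (n + 2)) (t : Simplex n) :
      Glue I ⟨⟨n + 1, σ⟩, faceIncl i t⟩ ⟨⟨n, σ.face i⟩, t⟩

/-- The classifying space `B(Q, I)`: the space obtained from the disjoint union of the simplices
of all cells by gluing, with the quotient topology. -/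
def ClassifyingSpace (I : TwoSidedIdeal (PathAlgebra k V)) := Quot (Glue I)

instance (I : TwoSidedIdeal (PathAlgebra k V)) : TopologicalSpace (ClassifyingSpace I) :=
  inferInstanceAs (TopologicalSpace (Quot (Glue I)))

/-! ## Vertices and arrows are cells -/

theorem longPaths_mul {a b : ℕ} {f g : PathAlgebra k V} (hf : f ∈ longPaths k V a)
    (hg : g ∈ longPaths k V b) : f * g ∈ longPaths k V (a + b) := by
  induction hf using Submodule.span_induction with
  | zero => rw [zero_mul]; exact zero_mem _
  | add f f' _ _ hf hf' => rw [add_mul]; exact add_mem hf hf'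
  | smul c f _ hf => rw [smul_mul_assoc]; exact Submodule.smul_mem _ _ hf
  | mem f hf =>
    obtain ⟨x, y, p, hp, rfl⟩ := hf
    induction hg using Submodule.span_induction with
    | zero => rw [mul_zero]; exact zero_mem _
    | add g g' _ _ hg hg' => rw [mul_add]; exact add_mem hg hg'
    | smul c g _ hg => rw [mul_smul_comm]; exact Submodule.smul_mem _ _ hg
    | mem g hg =>
      obtain ⟨x', y', q, hq, rfl⟩ := hg
      by_cases h : y = x'
      · subst h
        rw [path_mul_path]
        refine Submodule.subset_span ⟨_, _, _, ?_, rfl⟩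
        rw [Quiver.Path.length_comp]; omega
      · rw [path_mul_path_of_ne h]; exact zero_mem _

theorem arrowIdeal_sub {f : PathAlgebra k V} (hf : f ∈ arrowIdeal k V) :
    f ∈ longPaths k V 1 := by
  let J : TwoSidedIdeal (PathAlgebra k V) := TwoSidedIdeal.mk' (longPaths k V 1)
    (zero_mem _) (fun h h' => add_mem h h') (fun h => neg_mem h)
    (fun {x y} h => by simpa using longPaths_mul (mem_longPaths_zero x) h)
    (fun {x y} h => by simpa using longPaths_mul h (mem_longPaths_zero y))
  have hJ : arrowIdeal k V ≤ J := by
    refine TwoSidedIdeal.span_le.2 ?_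
    rintro _ ⟨x, y, a, rfl⟩
    refine (TwoSidedIdeal.mem_mk' _ _ _ _ _ _ _).2 ?_
    exact Submodule.subset_span ⟨x, y, a.toPath, le_rfl, rfl⟩
  exact (TwoSidedIdeal.mem_mk' _ _ _ _ _ _ _).1 (hJ hf)

theorem mem_of_mem_ideal_sq {R : Type*} [Ring R] (J : Ideal R) (P : AddSubmonoid R)
    (h : ∀ a ∈ J, ∀ b ∈ J, a * b ∈ P) {x : R} (hx : x ∈ J ^ 2) : x ∈ P := by
  have e : J ^ 2 = J ^ 1 * J := rfl
  rw [e, Submodule.pow_one] at hx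
  exact Submodule.smul_induction_on hx h (fun _ _ h h' => add_mem h h')

theorem arrowIdeal_sq_sub {f : PathAlgebra k V}
    (hf : f ∈ (arrowIdeal k V).asIdeal ^ 2) : f ∈ longPaths k V 2 := by
  have h := mem_of_mem_ideal_sq (arrowIdeal k V).asIdeal (longPaths k V 2).toAddSubmonoid
  have h2 := h (fun a ha b hb => by
    have hab := longPaths_mul (arrowIdeal_sub (TwoSidedIdeal.mem_asIdeal.1 ha))
      (arrowIdeal_sub (TwoSidedIdeal.mem_asIdeal.1 hb))
    exact hab) (x := f)
  exact h2 hf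

/-- Paths of length at most one do not lie in an admissible ideal. -/
theorem path_notMem {I : TwoSidedIdeal (PathAlgebra k V)} (hI : IsAdmissible I) {x y : V}
    (p : Quiver.Path x y) (hp : p.length < 2) : path p ∉ I := by
  intro h
  obtain ⟨m, -, -, hI⟩ := hI
  have h2 := arrowIdeal_sq_sub (hI (TwoSidedIdeal.mem_asIdeal.2 h))
  have key : ∀ f ∈ longPaths k V 2, (show QuiverPath V →₀ k from f) ⟨x, y, p⟩ = 0 := by
    intro f hf
    induction hf using Submodule.span_induction with
    | zero => rfl
    | add f g _ _ hf hg => erw [Finsupp.add_apply, hf, hg, add_zero]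
    | smul c f _ hf => erw [Finsupp.smul_apply, hf, smul_zero]
    | mem f hf =>
      obtain ⟨x', y', q, hq, rfl⟩ := hf
      refine Finsupp.single_eq_of_ne ?_
      intro e
      obtain ⟨rfl, e⟩ := Sigma.mk.inj_iff.1 e
      obtain ⟨rfl, e⟩ := Sigma.mk.inj_iff.1 (eq_of_heq e)
      obtain rfl := eq_of_heq e
      omega
  have := key _ h2
  erw [Finsupp.single_eq_same] at this
  exact one_ne_zero this

/-- The `0`-cell of a vertex. -/
def vertexCell {I : TwoSidedIdeal (PathAlgebra k V)} (hI : IsAdmissible I) (x : V) : Cell I 0 :=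
  ⟨ComposableArrows.mk₀ (C := Paths V) x ⋙ natClass I, ComposableArrows.mk₀ (C := Paths V) x,
    ⟨fun i => i.elim0, path_notMem hI (Quiver.Path.nil : Quiver.Path x x) Nat.zero_lt_two⟩, rfl⟩

/-- The `1`-cell of an arrow. -/
def arrowCell {I : TwoSidedIdeal (PathAlgebra k V)} (hI : IsAdmissible I) {x y : V} (a : x ⟶ y) :
    Cell I 1 :=
  ⟨ComposableArrows.mk₁ ((Paths.of V).map a) ⋙ natClass I,
    ComposableArrows.mk₁ ((Paths.of V).map a), ⟨fun i => by
      obtain rfl : i = 0 := Subsingleton.elim _ _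
      exact one_ne_zero, path_notMem hI a.toPath Nat.one_lt_two⟩, rfl⟩

/-- The face `∂_0` of the cell of an arrow is its target. -/
theorem face_zero_arrowCell {I : TwoSidedIdeal (PathAlgebra k V)} (hI : IsAdmissible I) {x y : V}
    (a : x ⟶ y) : (arrowCell hI a).face 0 = vertexCell hI y :=
  Subtype.ext (ComposableArrows.ext₀ rfl)

/-- The face `∂_1` of the cell of an arrow is its source. -/
theorem face_one_arrowCell {I : TwoSidedIdeal (PathAlgebra k V)} (hI : IsAdmissible I) {x y : V}
    (a : x ⟶ y) : (arrowCell hI a).face 1 = vertexCell hI x :=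
  Subtype.ext (ComposableArrows.ext₀ rfl)

end

/-! ## The underlying graph -/

section

variable (V : Type u) [Quiver.{v + 1} V]

/-- One point for each vertex and one closed edge for each arrow. -/
abbrev GraphPieces :=
  (Σ _ : V, Simplex 0) ⊕ (Σ _ : (Σ x y : V, x ⟶ y), Simplex 1)

/-- The face `t_0 = 0` of the edge of an arrow is glued to the target of the arrow, and the face
`t_1 = 0` to its source. -/
inductive GraphGlue : GraphPieces V → GraphPieces V → Prop
  | target {x y : V} (a : x ⟶ y) (t : Simplex 0) :
      GraphGlue (Sum.inr ⟨⟨x, y, a⟩, faceIncl 0 t⟩) (Sum.inl ⟨y, t⟩)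
  | source {x y : V} (a : x ⟶ y) (t : Simplex 0) :
      GraphGlue (Sum.inr ⟨⟨x, y, a⟩, faceIncl 1 t⟩) (Sum.inl ⟨x, t⟩)

/-- The underlying graph of the quiver, as a topological space. -/
def UnderlyingGraph := Quot (GraphGlue V)

instance : TopologicalSpace (UnderlyingGraph V) :=
  inferInstanceAs (TopologicalSpace (Quot (GraphGlue V)))

variable {V}

/-- The canonical map from the underlying graph to `B(Q, I)`: it sends the point of a vertex `x` to
the `0`-cell of `x`, and the edge of an arrow `a` to the `1`-cell of (the class of) `a`. -/
def graphMap {k : Type w} [Field k] [Fintype V] {I : TwoSidedIdeal (PathAlgebra k V)}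
    (hI : IsAdmissible I) : UnderlyingGraph V → ClassifyingSpace I :=
  Quot.lift
    (Sum.elim (fun p => Quot.mk _ ⟨⟨0, vertexCell hI p.1⟩, p.2⟩)
      (fun p => Quot.mk _ ⟨⟨1, arrowCell hI p.1.2.2⟩, p.2⟩))
    (by
      rintro _ _ (⟨a, t⟩ | ⟨a, t⟩)
      · exact (Quot.sound (Glue.face (arrowCell hI a) 0 t)).trans
          (by rw [face_zero_arrowCell]; rfl)
      · exact (Quot.sound (Glue.face (arrowCell hI a) 1 t)).trans
          (by rw [face_one_arrowCell]; rfl))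

end

end BoundQuiver

/-- `A` is a strong deformation retract of `X`: the identity of `X` is homotopic, relative
to `A`, to a map with values in `A`. -/
def IsStrongDeformationRetract {X : Type*} [TopologicalSpace X] (A : Set X) : Prop :=
  ∃ r : C(X, X), (∀ x, r x ∈ A) ∧ Nonempty ((ContinuousMap.id X).HomotopyRel r A)

end

/-! A monomial ideal is spanned by the paths it contains, so each single term of a relation in `I`
already lies in `I`, and minimal relations cannot exist. Natural homotopy is therefore trivial
(`IsMonomial.eq_of_comp_natClass`), and for `n ≥ 1` an `n`-cell is a path outside `I` cut into `n`
non-stationary pieces.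

Cutting such a path `w` of length `m` into its arrows gives an `m`-simplex, that of `spine w`. Any
other way of cutting `w` or one of its subpaths gives a face of this simplex, spanned by the
positions of the cuts (`whiskerLeft_spine`, `cellPoint_spine_map`). In particular a subpath gives
the face on a block of consecutive vertices. So to define a continuous map on the classifying space
it suffices to give continuous maps on the simplices of the nonzero paths that agree on such blocks;
this is `PathFamily` with its `desc`.

A point of the `m`-simplex is a system of weights on `0, …, m`, with a mean `μ`. Slide it along a
straight segment to the point with the same mean on the broken line `0, 1, …, m`. Mean and broken
line are translated together when a block is included, so these slides agree on blocks
(`flow_map_shift`). They do not preserve arbitrary faces: the edge from `0` to `2` of a triangle is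
pushed into its interior. At time `1` only edges between consecutive vertices remain, and these are
arrows (`flowFamily_desc_one`); simplices of dimension at most `1` never move (`flow_eq_self`). This
is the deformation.

The embedding uses the same mean: sending a point to the point of the graph at distance `μ` along
`w` defines a continuous left inverse of `graphMap` (`meanFamily_desc_graphMap`). -/

noncomputable section

namespace BoundQuiver

open PathAlgebra

/-! ### Monomial ideals have trivial natural homotopy -/

section Monomial

variable {k : Type w} {V : Type u} [Field k] [Quiver.{v + 1} V]

/-- The coefficient of a path in an element of `kQ`. -/
def coeff (q : QuiverPath V) : PathAlgebra k V →ₗ[k] k :=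
  (Finsupp.lapply q : (QuiverPath V →₀ k) →ₗ[k] k)

theorem coeff_single_self (q : QuiverPath V) : coeff q (single q : PathAlgebra k V) = 1 :=
  Finsupp.single_eq_same

theorem coeff_single_of_ne {q q' : QuiverPath V} (h : q ≠ q') :
    coeff q (single q' : PathAlgebra k V) = 0 :=
  Finsupp.single_eq_of_ne h

variable [Fintype V]

theorem smul_mem_ideal {I : TwoSidedIdeal (PathAlgebra k V)} (c : k) {f : PathAlgebra k V}
    (hf : f ∈ I) : c • f ∈ I := by
  have : c • f = (c • (1 : PathAlgebra k V)) * f := by rw [smul_mul_assoc, one_mul]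
  rw [this]
  exact I.mul_mem_left _ _ hf

/-- The elements of a monomial ideal are the linear combinations of the paths it contains. -/
theorem IsMonomial.mem_span {I : TwoSidedIdeal (PathAlgebra k V)} (hI : IsMonomial I)
    {f : PathAlgebra k V} (hf : f ∈ I) :
    f ∈ Submodule.span k {g : PathAlgebra k V | ∃ q, g = single q ∧ single q ∈ I} := by
  obtain ⟨S, hS⟩ := hI
  set M := Submodule.span k {g : PathAlgebra k V | ∃ q, g = single q ∧ single q ∈ I} with hM
  -- A product of two paths is a path or `0`, so multiplying by paths preserves the span `M`. This
  -- makes `M` a two-sided ideal containing the generators.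
  have key : ∀ p q : QuiverPath V, (single p ∈ I ∨ single q ∈ I) →
      (single p * single q : PathAlgebra k V) ∈ M := by
    rintro ⟨x, y, p⟩ ⟨x', y', q⟩ h
    have hpq : (path p * path q : PathAlgebra k V) ∈ I :=
      h.elim (fun h => I.mul_mem_right _ _ h) (fun h => I.mul_mem_left _ _ h)
    change (path p * path q : PathAlgebra k V) ∈ M
    by_cases e : y = x'
    · subst e
      rw [path_mul_path] at hpq ⊢
      exact Submodule.subset_span ⟨_, rfl, hpq⟩
    · rw [path_mul_path_of_ne e]; exact zero_mem _
  have left : ∀ {f g : PathAlgebra k V}, g ∈ M → f * g ∈ M := by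
    intro f g hg
    induction hg using Submodule.span_induction with
    | zero => rw [mul_zero]; exact zero_mem _
    | add g g' _ _ hg hg' => rw [mul_add]; exact add_mem hg hg'
    | smul c g _ hg => rw [mul_smul_comm]; exact Submodule.smul_mem _ _ hg
    | mem g hg =>
      obtain ⟨q, rfl, hq⟩ := hg
      induction f using PathAlgebra.induction_on with
      | h0 => rw [zero_mul]; exact zero_mem _
      | hadd f g hf hg => rw [add_mul]; exact add_mem hf hg
      | hpath c p => rw [smul_mul_assoc]; exact Submodule.smul_mem _ _ (key _ _ (Or.inr hq))
  have right : ∀ {f g : PathAlgebra k V}, f ∈ M → f * g ∈ M := by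
    intro f g hf
    induction hf using Submodule.span_induction with
    | zero => rw [zero_mul]; exact zero_mem _
    | add g g' _ _ hg hg' => rw [add_mul]; exact add_mem hg hg'
    | smul c g _ hg => rw [smul_mul_assoc]; exact Submodule.smul_mem _ _ hg
    | mem g hg =>
      obtain ⟨q, rfl, hq⟩ := hg
      induction g using PathAlgebra.induction_on with
      | h0 => rw [mul_zero]; exact zero_mem _
      | hadd f g hf hg => rw [mul_add]; exact add_mem hf hg
      | hpath c p => rw [mul_smul_comm]; exact Submodule.smul_mem _ _ (key _ _ (Or.inl hq))
  let J : TwoSidedIdeal (PathAlgebra k V) := TwoSidedIdeal.mk' (M : Set (PathAlgebra k V))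
    (zero_mem M) (fun h h' => add_mem (S := Submodule k (PathAlgebra k V)) h h')
    (fun h => neg_mem (S := Submodule k (PathAlgebra k V)) h) left right
  have hJ : I ≤ J := by
    rw [hS]
    refine TwoSidedIdeal.span_le.2 ?_
    rintro _ ⟨q, hq, rfl⟩
    refine (TwoSidedIdeal.mem_mk' _ _ _ _ _ _ _).2 ?_
    refine Submodule.subset_span ⟨q, rfl, ?_⟩
    rw [hS]
    exact TwoSidedIdeal.subset_span ⟨q, hq, rfl⟩
  exact (TwoSidedIdeal.mem_mk' _ _ _ _ _ _ _).1 (hJ hf)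

/-- If `q` were not in `I`, its coefficient functional would kill every path in `I`, hence their
span, which contains `f`. -/
theorem IsMonomial.single_mem {I : TwoSidedIdeal (PathAlgebra k V)} (hI : IsMonomial I)
    {f : PathAlgebra k V} (hf : f ∈ I) (q : QuiverPath V) (hq : coeff q f ≠ 0) :
    single q ∈ I := by
  by_contra hqI
  have h : Submodule.span k {g : PathAlgebra k V | ∃ q, g = single q ∧ single q ∈ I} ≤
      LinearMap.ker (coeff q) := by
    refine Submodule.span_le.2 ?_
    rintro _ ⟨q', rfl, hq'⟩
    exact coeff_single_of_ne (by rintro rfl; exact hqI hq')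
  exact hq (h (hI.mem_span hf))

/-- One term of the relation lies in `I` by itself, and it is a proper part because the support has
at least two elements. -/
theorem IsMonomial.not_isMinimalRelation {I : TwoSidedIdeal (PathAlgebra k V)}
    (hI : IsMonomial I) {x y : V} (ρ : Quiver.Path x y →₀ k) : ¬ IsMinimalRelation I ρ := by
  rintro ⟨hcard, hmem, hmin⟩
  obtain ⟨p, hp⟩ := Finset.card_pos.1 (zero_lt_two.trans_le hcard)
  refine hmin {p} ?_ (Finset.singleton_nonempty _) ?_
  · refine (Finset.ssubset_iff_subset_ne).2 ⟨Finset.singleton_subset_iff.2 hp, ?_⟩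
    intro e
    rw [← e, Finset.card_singleton] at hcard
    omega
  · rw [Finset.sum_singleton]
    refine smul_mem_ideal _ (hI.single_mem hmem ⟨_, _, p⟩ ?_)
    rw [map_sum, Finset.sum_eq_single_of_mem _ hp]
    · rw [map_smul, path, coeff_single_self]
      simpa using hp
    · intro b _ hb
      rw [map_smul, path, coeff_single_of_ne, smul_zero]
      rintro e
      exact hb (by simpa using e.symm)

/-- A monomial ideal has no minimal relations. -/
theorem IsMonomial.not_minRel {I : TwoSidedIdeal (PathAlgebra k V)} (hI : IsMonomial I)
    {x y : Paths V} {p q : x ⟶ y} : ¬ MinRel I p q := fun ⟨ρ, hρ, _⟩ =>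
  hI.not_isMinimalRelation ρ hρ

/-- For a monomial ideal, natural homotopy classes are paths. -/
def IsMonomial.natPathsFunctor {I : TwoSidedIdeal (PathAlgebra k V)} (hI : IsMonomial I) :
    NatPaths I ⥤ Paths V :=
  CategoryTheory.Quotient.lift _ (𝟭 (Paths V)) fun _ _ _ _ h => (hI.not_minRel h).elim

theorem IsMonomial.natClass_comp {I : TwoSidedIdeal (PathAlgebra k V)} (hI : IsMonomial I) :
    natClass I ⋙ hI.natPathsFunctor = 𝟭 (Paths V) :=
  CategoryTheory.Quotient.lift_spec _ _ _

/-- A cell thus has exactly one representing sequence of paths, so constructions on cells may choose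
a representative freely. -/
theorem IsMonomial.eq_of_comp_natClass {I : TwoSidedIdeal (PathAlgebra k V)} (hI : IsMonomial I)
    {n : ℕ} {G G' : ComposableArrows (Paths V) n} (h : G ⋙ natClass I = G' ⋙ natClass I) :
    G = G' := by
  have := congrArg (· ⋙ hI.natPathsFunctor) h
  simpa only [Functor.assoc, hI.natClass_comp, Functor.comp_id] using this

end Monomial

/-! ### Cutting a path into its arrows -/

section Spine

variable {V : Type u} [Quiver.{v + 1} V]

theorem exists_factor {x y : Paths V} (w : x ⟶ y) (i : Fin (homLength w + 1)) :
    ∃ (z : Paths V) (f : x ⟶ z) (g : z ⟶ y), w = f ≫ g ∧ homLength f = i := by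
  obtain ⟨z, f, g, h, e⟩ := Quiver.Path.exists_eq_comp_of_le_length (V := V) w
    (Nat.lt_succ_iff.1 i.2)
  exact ⟨z, f, g, h, e⟩

theorem comp_left_cancel {x y z : Paths V} (f : x ⟶ y) {g g' : y ⟶ z} (h : f ≫ g = f ≫ g') :
    g = g' :=
  (Quiver.Path.comp_inj_right (V := V)).1 h

/-- Paths grow at their target end, so equal last arrows are stripped from `g` and `g'` in step; the
length condition makes both run out together. -/
theorem path_factor_unique {x y z z' : V} (f : Quiver.Path x z) (g : Quiver.Path z y)
    (f' : Quiver.Path x z') (g' : Quiver.Path z' y) (h : f.comp g = f'.comp g')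
    (hl : f.length = f'.length) : z = z' ∧ HEq f f' := by
  induction g with
  | nil =>
    cases g' with
    | nil => exact ⟨rfl, heq_of_eq h⟩
    | cons g' b =>
      have := congrArg Quiver.Path.length h
      simp [Quiver.Path.length_comp] at this
      omega
  | cons g a ih =>
    cases g' with
    | nil =>
      have := congrArg Quiver.Path.length h
      simp [Quiver.Path.length_comp] at this
      omega
    | cons g' b =>
      rw [Quiver.Path.comp_cons, Quiver.Path.comp_cons] at h
      injection h with e1 _ e2 _
      subst e1
      exact ih g' (eq_of_heq e2)

/-- Two factorizations of a path whose first factors have the same length agree. -/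
theorem factor_unique {x y z z' : Paths V} {f : x ⟶ z} {g : z ⟶ y} {f' : x ⟶ z'} {g' : z' ⟶ y}
    (h : f ≫ g = f' ≫ g') (hl : homLength f = homLength f') : z = z' ∧ HEq f f' :=
  path_factor_unique (V := V) f g f' g' h hl

/-- The `i`-th vertex of a path. -/
def vertexAt {x y : Paths V} (w : x ⟶ y) (i : Fin (homLength w + 1)) : Paths V :=
  (exists_factor w i).choose

/-- The initial subpath of length `i`. -/
def initial {x y : Paths V} (w : x ⟶ y) (i : Fin (homLength w + 1)) : x ⟶ vertexAt w i :=
  (exists_factor w i).choose_spec.choose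

/-- The terminal subpath starting at the `i`-th vertex. -/
def terminal {x y : Paths V} (w : x ⟶ y) (i : Fin (homLength w + 1)) : vertexAt w i ⟶ y :=
  (exists_factor w i).choose_spec.choose_spec.choose

theorem initial_comp_terminal {x y : Paths V} (w : x ⟶ y) (i : Fin (homLength w + 1)) :
    initial w i ≫ terminal w i = w :=
  (exists_factor w i).choose_spec.choose_spec.choose_spec.1.symm

theorem homLength_initial {x y : Paths V} (w : x ⟶ y) (i : Fin (homLength w + 1)) :
    homLength (initial w i) = i :=
  (exists_factor w i).choose_spec.choose_spec.choose_spec.2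

theorem exists_middle {x y : Paths V} (w : x ⟶ y) {i j : Fin (homLength w + 1)} (h : i ≤ j) :
    ∃ m : vertexAt w i ⟶ vertexAt w j, initial w i ≫ m = initial w j := by
  have hi : (i : ℕ) < homLength (initial w j) + 1 := by
    rw [homLength_initial]; exact Nat.lt_succ_of_le h
  obtain ⟨z, f, g, e, hf⟩ := exists_factor (initial w j) ⟨i, hi⟩
  -- Both `initial w i` and `f` are initial subpaths of `w` of length `i`, so they coincide.
  have e' : initial w i ≫ terminal w i = f ≫ (g ≫ terminal w j) := by
    rw [← Category.assoc, ← e, initial_comp_terminal, initial_comp_terminal]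
  obtain ⟨rfl, h2⟩ := factor_unique e' (by rw [homLength_initial, hf])
  obtain rfl := eq_of_heq h2
  exact ⟨g, e.symm⟩

/-- The path `w = a₁ ⋯ aₙ`, as the sequence of its arrows. -/
def spine {x y : Paths V} (w : x ⟶ y) : ComposableArrows (Paths V) (homLength w) where
  obj := vertexAt w
  map f := (exists_middle w (leOfHom f)).choose
  map_id i := comp_left_cancel (initial w i) (by
    rw [(exists_middle w le_rfl).choose_spec, Category.comp_id])
  map_comp {i j l} f g := comp_left_cancel (initial w i) (by
    rw [(exists_middle w (leOfHom (f ≫ g))).choose_spec, ← Category.assoc,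
      (exists_middle w (leOfHom f)).choose_spec, (exists_middle w (leOfHom g)).choose_spec])

theorem initial_comp_map {x y : Paths V} (w : x ⟶ y) {i j : Fin (homLength w + 1)} (f : i ⟶ j) :
    initial w i ≫ (spine w).map f = initial w j :=
  (exists_middle w (leOfHom f)).choose_spec

theorem homLength_spine_map {x y : Paths V} (w : x ⟶ y) {i j : Fin (homLength w + 1)}
    (f : i ⟶ j) : (i : ℕ) + homLength ((spine w).map f) = j := by
  have h : homLength (initial w i) + homLength ((spine w).map f) = homLength (initial w j) :=
    (homLength_comp _ _).symm.trans (congrArg homLength (initial_comp_map w f))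
  rwa [homLength_initial, homLength_initial] at h

section

variable {x y : Paths V} {n : ℕ} (G : ComposableArrows (Paths V) n) (a : x ⟶ G.obj 0)
  (b : G.obj (Fin.last n) ⟶ y) {w : x ⟶ y}
  (h : a ≫ G.map (homOfLE (Fin.zero_le (Fin.last n))) ≫ b = w)

/-- The path from `x` to the `j`-th vertex of `G`. -/
def upTo (j : Fin (n + 1)) : x ⟶ G.obj j := a ≫ G.map (homOfLE (Fin.zero_le j))

theorem upTo_comp_map {i j : Fin (n + 1)} (f : i ⟶ j) : upTo G a i ≫ G.map f = upTo G a j := by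
  rw [upTo, upTo, Category.assoc, ← G.map_comp]; rfl

include h in
theorem upTo_comp_rest (j : Fin (n + 1)) :
    upTo G a j ≫ (G.map (homOfLE (Fin.le_last j)) ≫ b) = w := by
  rw [← Category.assoc, upTo_comp_map, upTo, Category.assoc, h]

include h in
theorem homLength_upTo_lt (j : Fin (n + 1)) : homLength (upTo G a j) < homLength w + 1 := by
  rw [← upTo_comp_rest G a b h j, homLength_comp]; omega

/-- The position in `w` of the `j`-th vertex of `G`. -/
def position (j : Fin (n + 1)) : Fin (homLength w + 1) :=
  ⟨homLength (upTo G a j), homLength_upTo_lt G a b h j⟩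

theorem position_monotone : Monotone (position G a b h) := by
  intro i j hij
  change homLength (upTo G a i) ≤ homLength (upTo G a j)
  rw [← upTo_comp_map G a (homOfLE hij), homLength_comp]
  omega

theorem position_strictMono
    (hG : ∀ i : Fin n, homLength (G.map (homOfLE i.castSucc_le_succ)) ≠ 0) :
    StrictMono (position G a b h) := by
  refine Fin.strictMono_iff_lt_succ.2 fun i => ?_
  change homLength (upTo G a i.castSucc) < homLength (upTo G a i.succ)
  rw [← upTo_comp_map G a (homOfLE i.castSucc_le_succ), homLength_comp]
  have := hG i
  omega

/-- A middle piece of a path is determined by the initial subpaths ending at its two endpoints. The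
heterogeneous form is needed because the vertices of a spine are chosen, hence only propositionally
equal to those of `G`. -/
theorem map_heq {x z₁ z₂ z₁' z₂' : Paths V} {f : x ⟶ z₁} {f' : x ⟶ z₁'} {g : x ⟶ z₂}
    {g' : x ⟶ z₂'} (e₁ : z₁ = z₁') (hf : HEq f f') (e₂ : z₂ = z₂') (hg : HEq g g')
    {m : z₁ ⟶ z₂} {m' : z₁' ⟶ z₂'} (h : f ≫ m = g) (h' : f' ≫ m' = g') : HEq m m' := by
  subst e₁ e₂
  obtain rfl := eq_of_heq hf
  obtain rfl := eq_of_heq hg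
  exact heq_of_eq (comp_left_cancel f (h.trans h'.symm))

/-- A sequence of composable paths, inside a path `w`, is a restriction of the spine of `w`. -/
theorem whiskerLeft_spine : (spine w).whiskerLeft (position_monotone G a b h).functor = G := by
  have key : ∀ j, vertexAt w (position G a b h j) = G.obj j ∧
      HEq (initial w (position G a b h j)) (upTo G a j) := fun j =>
    factor_unique ((initial_comp_terminal w _).trans (upTo_comp_rest G a b h j).symm)
      (homLength_initial w _)
  refine Functor.hext (fun j => (key j).1) fun i j f => ?_
  exact map_heq (key i).1 (key i).2 (key j).1 (key j).2
    (initial_comp_map w ((position_monotone G a b h).functor.map f)) (upTo_comp_map G a f)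

end

end Spine

/-! ### The straight-line flow of a simplex onto its broken line -/

section SimplexFlow

theorem map_apply_of_injective {m n : ℕ} {f : Fin (n + 1) → Fin (m + 1)}
    (hf : Function.Injective f) (t : Simplex n) (j : Fin (n + 1)) :
    stdSimplex.map f t (f j) = t j := by
  rw [stdSimplex.map_coe, FunOnFinite.linearMap_apply_apply, Finset.sum_eq_single_of_mem j]
  · simp
  · intro b hb hbj
    exact absurd (hf (by simpa using hb)) hbj

theorem map_apply_of_notMem {m n : ℕ} {f : Fin (n + 1) → Fin (m + 1)} (t : Simplex n)
    {i : Fin (m + 1)} (hi : ∀ j, f j ≠ i) : stdSimplex.map f t i = 0 := by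
  rw [stdSimplex.map_coe, FunOnFinite.linearMap_apply_apply]
  refine Finset.sum_eq_zero fun j hj => ?_
  exact absurd (by simpa using hj) (hi j)

theorem eq_map_of_injective {m n : ℕ} {f : Fin (n + 1) → Fin (m + 1)}
    (hf : Function.Injective f) {τ : Simplex m} {t : Simplex n} (h : ∀ j, τ (f j) = t j)
    (h0 : ∀ i, (∀ j, f j ≠ i) → τ i = 0) : τ = stdSimplex.map f t := by
  ext i
  by_cases hi : ∃ j, f j = i
  · obtain ⟨j, rfl⟩ := hi
    rw [h, map_apply_of_injective hf]
  · push Not at hi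
    rw [h0 i hi, map_apply_of_notMem t hi]

/-- The mean of the index, for the weights given by a point of the simplex. -/
def mean {m : ℕ} (τ : Simplex m) : ℝ := ∑ j, τ j * (j : ℕ)

theorem continuous_coord {m : ℕ} (j : Fin (m + 1)) : Continuous fun τ : Simplex m => τ j :=
  (continuous_apply j).comp continuous_subtype_val

theorem continuous_mean {m : ℕ} : Continuous (mean : Simplex m → ℝ) :=
  continuous_finsetSum _ fun j _ => (continuous_coord j).mul continuous_const

theorem mean_nonneg {m : ℕ} (τ : Simplex m) : 0 ≤ mean τ :=
  Finset.sum_nonneg fun j _ => mul_nonneg (τ.2.1 j) (Nat.cast_nonneg _)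

theorem mean_le {m : ℕ} (τ : Simplex m) : mean τ ≤ m := by
  calc mean τ ≤ ∑ j, τ j * (m : ℝ) := Finset.sum_le_sum fun j _ =>
        mul_le_mul_of_nonneg_left (by exact_mod_cast Nat.lt_succ_iff.1 j.2) (τ.2.1 j)
    _ = m := by rw [← Finset.sum_mul, stdSimplex.sum_eq_one, one_mul]

theorem mean_map {m n : ℕ} (f : Fin (n + 1) → Fin (m + 1)) (t : Simplex n) :
    mean (stdSimplex.map f t) = ∑ j, t j * (f j : ℕ) := by
  simp only [mean, stdSimplex.map_coe, FunOnFinite.linearMap_apply_apply, Finset.sum_mul]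
  rw [← Finset.sum_fiberwise Finset.univ f]
  refine Finset.sum_congr rfl fun i _ => Finset.sum_congr rfl fun j hj => ?_
  rw [(Finset.mem_filter.1 hj).2]

theorem mean_map_shift {m n a : ℕ} {f : Fin (n + 1) → Fin (m + 1)}
    (hf : ∀ j, (f j : ℕ) = a + j) (t : Simplex n) :
    mean (stdSimplex.map f t) = a + mean t := by
  simp only [mean_map, hf, Nat.cast_add, mul_add, Finset.sum_add_distrib]
  rw [← Finset.sum_mul, stdSimplex.sum_eq_one, one_mul, mean]

/-- The piecewise linear function with value `1` at `j` and `0` at the other integers. -/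
def hat (μ : ℝ) (j : ℕ) : ℝ := max 0 (1 - |μ - j|)

theorem continuous_hat (j : ℕ) : Continuous fun μ => hat μ j := by
  unfold hat; fun_prop

theorem hat_eq_zero {μ : ℝ} {j : ℕ} (h : 1 ≤ |μ - j|) : hat μ j = 0 :=
  max_eq_left (by linarith)

theorem hat_of_le {μ : ℝ} {j : ℕ} (h : (j : ℝ) ≤ μ) (h' : μ ≤ j + 1) :
    hat μ j = 1 - (μ - j) := by
  rw [hat, abs_of_nonneg (by linarith), max_eq_right (by linarith)]

theorem hat_succ_of_le {μ : ℝ} {j : ℕ} (h : (j : ℝ) ≤ μ) (h' : μ ≤ j + 1) :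
    hat μ (j + 1) = μ - j := by
  rw [hat, Nat.cast_add, Nat.cast_one, abs_of_nonpos (by linarith), max_eq_right (by linarith)]
  ring

theorem hat_add (μ : ℝ) (a j : ℕ) : hat (a + μ) (a + j) = hat μ j := by
  rw [hat, hat, Nat.cast_add, add_sub_add_left_eq_sub]

/-- To the right of `m` only the last hat can be nonzero. This covers the final unit interval in the
induction for `sum_hat`. -/
theorem sum_hat_of_ge (m : ℕ) : ∀ {μ : ℝ}, (m : ℝ) ≤ μ →
    ∑ j ∈ Finset.range (m + 1), hat μ j = max 0 (1 - (μ - m)) := by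
  induction m with
  | zero =>
    intro μ h
    rw [Finset.sum_range_one, hat, abs_of_nonneg (by simpa using h)]
  | succ m ih =>
    intro μ h
    push_cast at h
    rw [Finset.sum_range_succ, ih (by linarith), max_eq_left (by linarith), zero_add, hat,
      abs_of_nonneg (by push_cast; linarith)]

theorem sum_hat (m : ℕ) {μ : ℝ} (h0 : 0 ≤ μ) (h1 : μ ≤ m) :
    ∑ j ∈ Finset.range (m + 1), hat μ j = 1 := by
  induction m with
  | zero =>
    have : μ = 0 := le_antisymm (by simpa using h1) h0
    simp [hat, this]
  | succ m ih =>
    push_cast at h1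
    rw [Finset.sum_range_succ]
    rcases le_total μ m with h | h
    · rw [ih h, hat_eq_zero, add_zero]
      push_cast
      rw [abs_of_nonpos (by linarith)]
      linarith
    · rw [sum_hat_of_ge m h, max_eq_right (by linarith), hat_succ_of_le h h1]
      ring

/-- The point of the broken line through the vertices `0`, `1`, …, `m` with mean `μ`. -/
def spinePoint {m : ℕ} (μ : ℝ) (h0 : 0 ≤ μ) (h1 : μ ≤ m) : Simplex m :=
  ⟨fun j => hat μ j, fun _ => le_max_left _ _, by
    rw [Fin.sum_univ_eq_sum_range (hat μ) (m + 1)]; exact sum_hat m h0 h1⟩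

/-- The straight line from a point of the simplex to the point of the broken line through the
vertices with the same mean. -/
def flow {m : ℕ} (s : unitInterval) (τ : Simplex m) : Simplex m :=
  ⟨(1 - (s : ℝ)) • (τ : Fin (m + 1) → ℝ) +
      (s : ℝ) • (spinePoint (mean τ) (mean_nonneg τ) (mean_le τ) : Fin (m + 1) → ℝ),
    convex_stdSimplex ℝ _ τ.2 (spinePoint _ _ _).2 (sub_nonneg.2 s.2.2) s.2.1 (by ring)⟩

theorem flow_apply {m : ℕ} (s : unitInterval) (τ : Simplex m) (j : Fin (m + 1)) :
    flow s τ j = (1 - (s : ℝ)) * τ j + s * hat (mean τ) j := rfl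

theorem continuous_flow {m : ℕ} :
    Continuous fun p : Simplex m × unitInterval => flow p.2 p.1 := by
  refine Continuous.subtype_mk (continuous_pi fun j => ?_) _
  have h1 := (continuous_coord j).comp (continuous_fst (X := Simplex m) (Y := unitInterval))
  have h2 := ((continuous_hat j).comp continuous_mean).comp
    (continuous_fst (X := Simplex m) (Y := unitInterval))
  have h3 := continuous_subtype_val.comp (continuous_snd (X := Simplex m) (Y := unitInterval))
  exact ((continuous_const.sub h3).mul h1).add (h3.mul h2)

theorem flow_zero {m : ℕ} (τ : Simplex m) : flow 0 τ = τ := by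
  ext j
  simp [flow_apply]

/-- The mean moves by `a`, and so do the hats of the block. A vertex outside the block is at
distance at least `1` from the mean, so its hat vanishes and the flow stays in the face.
Consecutiveness of the vertices is essential. -/
theorem flow_map_shift {m n a : ℕ} {f : Fin (n + 1) → Fin (m + 1)}
    (hf : ∀ j, (f j : ℕ) = a + j) (s : unitInterval) (t : Simplex n) :
    flow s (stdSimplex.map f t) = stdSimplex.map f (flow s t) := by
  have hinj : Function.Injective f := fun i j h => by
    have := hf i
    rw [h, hf j] at this
    exact Fin.ext (by omega)
  refine eq_map_of_injective hinj (fun j => ?_) fun i hi => ?_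
  · rw [flow_apply, flow_apply, map_apply_of_injective hinj, mean_map_shift hf, hf, hat_add]
  · rw [flow_apply, map_apply_of_notMem t hi, hat_eq_zero, mul_zero, mul_zero, add_zero]
    rw [mean_map_shift hf]
    have h0 := mean_nonneg t
    have h1 := mean_le t
    rcases lt_or_ge (i : ℕ) a with h | h
    · have : ((i : ℕ) : ℝ) + 1 ≤ a := by exact_mod_cast h
      exact le_trans (by linarith) (le_abs_self _)
    · have h2 : a + n + 1 ≤ (i : ℕ) := by
        by_contra hc
        refine hi ⟨i - a, by omega⟩ (Fin.ext ?_)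
        rw [hf]
        simp only
        omega
      have : (a : ℝ) + n + 1 ≤ ((i : ℕ) : ℝ) := by exact_mod_cast h2
      exact le_trans (by linarith) (neg_le_abs _)

/-- In these dimensions the broken line is the whole simplex, and a point is determined by its mean.
-/
theorem flow_eq_self {m : ℕ} (hm : m ≤ 1) (s : unitInterval) (τ : Simplex m) : flow s τ = τ := by
  interval_cases m
  · exact Subsingleton.elim _ _
  · have h : mean τ = τ 1 := by simp [mean]
    have h0 := τ.2.1 1
    have h1 := stdSimplex.le_one τ 1
    have h2 := stdSimplex.add_eq_one τ
    have e : ∀ j : Fin 2, hat (mean τ) j = τ j := by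
      intro j
      rw [h]
      fin_cases j
      · exact (hat_of_le (j := 0) (by simp) (by simp)).trans (by
          simp; linarith)
      · exact (hat_succ_of_le (j := 0) (by simp) (by simp)).trans (by simp)
    ext j
    rw [flow_apply, e]
    ring

/-- The point of the `1`-simplex at distance `s` from the vertex `0` (with `s` cut off to
`[0, 1]`). -/
def edgeCoord (s : ℝ) : Simplex 1 :=
  ⟨![1 - (Set.projIcc (0 : ℝ) 1 zero_le_one s : ℝ), Set.projIcc (0 : ℝ) 1 zero_le_one s], by
    intro j
    have := (Set.projIcc (0 : ℝ) 1 zero_le_one s).2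
    fin_cases j
    · exact sub_nonneg.2 this.2
    · exact this.1, by
    rw [Fin.sum_univ_two]; simp⟩

theorem continuous_edgeCoord : Continuous edgeCoord := by
  refine Continuous.subtype_mk (continuous_pi fun j => ?_) _
  have : Continuous fun s : ℝ => (Set.projIcc (0 : ℝ) 1 zero_le_one s : ℝ) :=
    continuous_subtype_val.comp continuous_projIcc
  fin_cases j
  · exact continuous_const.sub this
  · exact this

theorem edgeCoord_apply_zero {s : ℝ} (hs : s ∈ Set.Icc (0 : ℝ) 1) : edgeCoord s 0 = 1 - s := by
  change 1 - (Set.projIcc (0 : ℝ) 1 zero_le_one s : ℝ) = 1 - s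
  rw [Set.projIcc_of_mem _ hs]

theorem edgeCoord_apply_one {s : ℝ} (hs : s ∈ Set.Icc (0 : ℝ) 1) : edgeCoord s 1 = s := by
  change (Set.projIcc (0 : ℝ) 1 zero_le_one s : ℝ) = s
  rw [Set.projIcc_of_mem _ hs]

theorem edgeCoord_of_le {s : ℝ} (hs : s ≤ 0) : edgeCoord s = edgeCoord 0 := by
  unfold edgeCoord
  simp only [Set.projIcc_of_le_left zero_le_one hs, Set.projIcc_left]

theorem edgeCoord_of_ge {s : ℝ} (hs : 1 ≤ s) : edgeCoord s = edgeCoord 1 := by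
  unfold edgeCoord
  simp only [Set.projIcc_of_right_le zero_le_one hs, Set.projIcc_right]

theorem edgeCoord_eq (τ : Simplex 1) : edgeCoord (τ 1) = τ := by
  have hs : τ 1 ∈ Set.Icc (0 : ℝ) 1 := ⟨τ.2.1 1, stdSimplex.le_one τ 1⟩
  have := stdSimplex.add_eq_one τ
  ext j
  fin_cases j
  · exact (edgeCoord_apply_zero hs).trans (by simp; linarith)
  · exact edgeCoord_apply_one hs

/-- At time `1` the flow reaches an edge joining consecutive vertices. -/
theorem exists_flow_one_eq {m : ℕ} (hm : m ≠ 0) (τ : Simplex m) :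
    ∃ (i : ℕ) (f : Fin 2 → Fin (m + 1)) (t : Simplex 1), (f 0 : ℕ) = i ∧ (f 1 : ℕ) = i + 1 ∧
      flow 1 τ = stdSimplex.map f t := by
  have h0 := mean_nonneg τ
  have h1 := mean_le τ
  obtain ⟨i, hi, hl, hr⟩ : ∃ i : ℕ, i < m ∧ (i : ℝ) ≤ mean τ ∧ mean τ ≤ i + 1 := by
    by_cases h : ⌊mean τ⌋₊ < m
    · exact ⟨_, h, Nat.floor_le h0, (Nat.lt_floor_add_one _).le⟩
    -- At the last vertex the floor is `m`, which starts no edge; the edge ending there, from `m -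
    -- 1`, is used instead.
    · have h2 : (m : ℝ) ≤ mean τ := (Nat.le_floor_iff h0).1 (not_lt.1 h)
      have h3 : ((m - 1 : ℕ) : ℝ) + 1 = m := by
        exact_mod_cast Nat.succ_pred_eq_of_ne_zero hm
      exact ⟨m - 1, by omega, by linarith, by linarith⟩
  have hs : mean τ - i ∈ Set.Icc (0 : ℝ) 1 := ⟨by linarith, by linarith⟩
  refine ⟨i, ![⟨i, by omega⟩, ⟨i + 1, by omega⟩], edgeCoord (mean τ - i), rfl, rfl, ?_⟩
  refine eq_map_of_injective ?_ (fun j => ?_) fun j hj => ?_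
  · intro a b hab
    fin_cases a <;> fin_cases b <;> simp_all
  · rw [flow_apply]
    fin_cases j
    · exact (by simp [hat_of_le hl hr] : _ = 1 - (mean τ - i)).trans (edgeCoord_apply_zero hs).symm
    · exact (by simp [hat_succ_of_le hl hr] : _ = mean τ - i).trans (edgeCoord_apply_one hs).symm
  · have hj0 : (j : ℕ) ≠ i := fun h => hj 0 (Fin.ext h.symm)
    have hj1 : (j : ℕ) ≠ i + 1 := fun h => hj 1 (Fin.ext h.symm)
    rw [flow_apply, hat_eq_zero]
    · simp
    · rcases lt_or_ge (j : ℕ) i with h | h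
      · have : ((j : ℕ) : ℝ) + 1 ≤ i := by exact_mod_cast h
        exact le_trans (by linarith) (le_abs_self _)
      · have h2 : i + 2 ≤ (j : ℕ) := by omega
        have : (i : ℝ) + 2 ≤ ((j : ℕ) : ℝ) := by exact_mod_cast h2
        exact le_trans (by linarith) (neg_le_abs _)

end SimplexFlow

open PathAlgebra

/-! ### Travelling along a path in the underlying graph -/

section GraphPoints

variable {V : Type u} [Quiver.{v + 1} V]

/-- The point of the underlying graph given by a vertex. -/
def vertexPoint (x : V) : UnderlyingGraph V := Quot.mk _ (Sum.inl ⟨x, default⟩)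

/-- The point at distance `s` from the source on the edge of an arrow. -/
def edgePoint {x y : V} (a : x ⟶ y) (s : ℝ) : UnderlyingGraph V :=
  Quot.mk _ (Sum.inr ⟨⟨x, y, a⟩, edgeCoord s⟩)

theorem continuous_edgePoint {x y : V} (a : x ⟶ y) : Continuous (edgePoint a) := by
  refine continuous_quot_mk.comp (continuous_inr.comp (Continuous.comp ?_ continuous_edgeCoord))
  exact continuous_sigmaMk (σ := fun _ : (Σ x y : V, x ⟶ y) => Simplex 1) (i := ⟨x, y, a⟩)

theorem edgePoint_of_le {x y : V} (a : x ⟶ y) {s : ℝ} (hs : s ≤ 0) :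
    edgePoint a s = vertexPoint x := by
  rw [edgePoint, edgeCoord_of_le hs]
  refine Eq.trans ?_ (Quot.sound (GraphGlue.source a default))
  congr 3
  refine eq_map_of_injective (Fin.succAbove_right_injective (p := 1)) (fun j => ?_) fun i hi => ?_
  · obtain rfl : j = 0 := Fin.ext (by omega)
    exact (edgeCoord_apply_zero (by simp)).trans (by simp)
  · fin_cases i
    · exact absurd rfl (hi 0)
    · exact edgeCoord_apply_one (by simp)

theorem edgePoint_of_ge {x y : V} (a : x ⟶ y) {s : ℝ} (hs : 1 ≤ s) :
    edgePoint a s = vertexPoint y := by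
  rw [edgePoint, edgeCoord_of_ge hs]
  refine Eq.trans ?_ (Quot.sound (GraphGlue.target a default))
  congr 3
  refine eq_map_of_injective (Fin.succAbove_right_injective (p := 0)) (fun j => ?_) fun i hi => ?_
  · obtain rfl : j = 0 := Fin.ext (by omega)
    exact (edgeCoord_apply_one (by simp)).trans (by simp)
  · fin_cases i
    · exact (edgeCoord_apply_zero (by simp)).trans (by simp)
    · exact absurd rfl (hi 0)

/-- The point at distance `s` from the source on a path in the underlying graph. -/
def pathPoint {x : V} : ∀ {y : V}, Quiver.Path x y → ℝ → UnderlyingGraph V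
  | _, Quiver.Path.nil, _ => vertexPoint x
  | _, Quiver.Path.cons p a, s =>
    if s ≤ (p.length : ℝ) then pathPoint p s else edgePoint a (s - p.length)

theorem pathPoint_cons_of_le {x y z : V} (p : Quiver.Path x y) (a : y ⟶ z) {s : ℝ}
    (hs : s ≤ p.length) : pathPoint (p.cons a) s = pathPoint p s := if_pos hs

theorem pathPoint_of_ge {x y : V} (p : Quiver.Path x y) {s : ℝ} (hs : (p.length : ℝ) ≤ s) :
    pathPoint p s = vertexPoint y := by
  cases p with
  | nil => rfl
  | cons p a =>
    rw [Quiver.Path.length_cons, Nat.cast_add, Nat.cast_one] at hs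
    rw [pathPoint, if_neg (by linarith)]
    exact edgePoint_of_ge a (by linarith)

/-- The two branches of `pathPoint` agree at the junction `s = p.length`, where both give the common
vertex `y`; this is also what makes `pathPoint` continuous. -/
theorem pathPoint_cons_of_ge {x y z : V} (p : Quiver.Path x y) (a : y ⟶ z) {s : ℝ}
    (hs : p.length ≤ s) : pathPoint (p.cons a) s = edgePoint a (s - p.length) := by
  rw [pathPoint]
  split_ifs with h
  · rw [pathPoint_of_ge p hs, edgePoint_of_le a (by linarith)]
  · rfl

theorem continuous_pathPoint {x y : V} (p : Quiver.Path x y) : Continuous (pathPoint p) := by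
  induction p with
  | nil => exact continuous_const
  | cons p a ih =>
    refine Continuous.if_le ih
      ((continuous_edgePoint a).comp (continuous_id.sub continuous_const)) continuous_id
      continuous_const fun s hs => ?_
    rw [pathPoint_of_ge p (ge_of_eq hs)]
    exact (edgePoint_of_le a (sub_nonpos.2 (le_of_eq hs))).symm

theorem pathPoint_comp_of_le {x y z : V} (p : Quiver.Path x y) (q : Quiver.Path y z) {s : ℝ}
    (hs : s ≤ p.length) : pathPoint (p.comp q) s = pathPoint p s := by
  induction q with
  | nil => rfl
  | cons q a ih =>
    rw [Quiver.Path.comp_cons, pathPoint_cons_of_le, ih]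
    rw [Quiver.Path.length_comp, Nat.cast_add]
    have := Nat.cast_nonneg (α := ℝ) q.length
    linarith

theorem pathPoint_comp_add {x y z : V} (p : Quiver.Path x y) (q : Quiver.Path y z) {s : ℝ}
    (hs : 0 ≤ s) : pathPoint (p.comp q) (p.length + s) = pathPoint q s := by
  induction q with
  | nil => exact pathPoint_of_ge p (by linarith)
  | cons q a ih =>
    have hl : ((p.comp q).length : ℝ) = p.length + q.length := by
      rw [Quiver.Path.length_comp, Nat.cast_add]
    rw [Quiver.Path.comp_cons]
    rcases le_total s q.length with h | h
    · rw [pathPoint_cons_of_le _ _ h, pathPoint_cons_of_le _ _ (by linarith), ih]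
    · rw [pathPoint_cons_of_ge _ _ h, pathPoint_cons_of_ge _ _ (by linarith), hl,
        add_sub_add_left_eq_sub]

/-- The point at distance `s` from the source on a path, seen as a morphism of the path
category. -/
def homPoint {x y : Paths V} (w : x ⟶ y) (s : ℝ) : UnderlyingGraph V := pathPoint (V := V) w s

theorem homPoint_comp_comp {x x' y' y : Paths V} (a : x ⟶ x') (w : x' ⟶ y') (b : y' ⟶ y) {s : ℝ}
    (h0 : 0 ≤ s) (h1 : s ≤ homLength w) :
    homPoint (a ≫ w ≫ b) (homLength a + s) = homPoint w s :=
  (pathPoint_comp_add (V := V) a (w ≫ b) h0).trans (pathPoint_comp_of_le (V := V) w b h1)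

end GraphPoints

/-! ### Maps out of the classifying space from families on paths -/

section Descent

variable {k : Type w} {V : Type u} [Field k] [Quiver.{v + 1} V]

/-- The composition of a sequence of composable paths. -/
def total {n : ℕ} (G : ComposableArrows (Paths V) n) : G.obj 0 ⟶ G.obj (Fin.last n) :=
  G.map (homOfLE (Fin.zero_le (Fin.last n)))

theorem id_total_id {n : ℕ} (G : ComposableArrows (Paths V) n) :
    𝟙 _ ≫ G.map (homOfLE (Fin.zero_le (Fin.last n))) ≫ 𝟙 _ = total G := by
  rw [Category.id_comp, Category.comp_id, total]

variable [Fintype V] {I : TwoSidedIdeal (PathAlgebra k V)}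

theorem IsGood.total_notMem {n : ℕ} {G : ComposableArrows (Paths V) n} (hG : IsGood I G) :
    homElt k (total G) ∉ I := hG.2

/-- The cell of a good sequence. -/
def cellOf {n : ℕ} (G : ComposableArrows (Paths V) n) (hG : IsGood I G) : Cell I n :=
  ⟨G ⋙ natClass I, G, hG, rfl⟩

/-- The point of the classifying space in the simplex of a good sequence. -/
def cellPoint {n : ℕ} (G : ComposableArrows (Paths V) n) (hG : IsGood I G) (t : Simplex n) :
    ClassifyingSpace I :=
  Quot.mk _ ⟨⟨n, cellOf G hG⟩, t⟩

theorem cellPoint_congr {n : ℕ} {G G' : ComposableArrows (Paths V) n} (h : G = G')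
    (hG : IsGood I G) (hG' : IsGood I G') (t : Simplex n) :
    cellPoint G hG t = cellPoint G' hG' t := by
  subst h; rfl

theorem continuous_cellPoint {n : ℕ} (G : ComposableArrows (Paths V) n) (hG : IsGood I G) :
    Continuous (cellPoint G hG) :=
  continuous_quot_mk.comp
    (continuous_sigmaMk (σ := fun c : (Σ n, Cell I n) => Simplex c.1) (i := ⟨n, cellOf G hG⟩))

theorem IsGood.whiskerLeft {n m : ℕ} {G : ComposableArrows (Paths V) m} (hG : IsGood I G)
    {f : Fin (n + 1) → Fin (m + 1)} (hf : StrictMono f) :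
    IsGood I (G.whiskerLeft hf.monotone.functor) := by
  refine ⟨fun j => ?_, fun h => hG.2 ?_⟩
  · exact length_ne_zero_of_lt hG (hf (Fin.castSucc_lt_succ (i := j)))
  · have e : G.map (homOfLE (Fin.zero_le (Fin.last m))) =
        G.map (homOfLE (Fin.zero_le (f 0))) ≫
          G.map (homOfLE (hf.monotone (Fin.zero_le (Fin.last n)))) ≫
            G.map (homOfLE (Fin.le_last (f (Fin.last n)))) := by
      rw [← G.map_comp, ← G.map_comp]; rfl
    rw [e, homElt_comp, homElt_comp]
    exact I.mul_mem_left _ _ (I.mul_mem_right _ _ h)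

theorem cellPoint_faceIncl {n : ℕ} (G : ComposableArrows (Paths V) (n + 1)) (hG : IsGood I G)
    (i : Fin (n + 2)) (t : Simplex n) :
    cellPoint G hG (faceIncl i t) = cellPoint (G.whiskerLeft (skip i)) (hG.skip i) t :=
  Quot.sound (Glue.face (cellOf G hG) i t)

/-- The simplex of a restricted sequence is glued to the corresponding face. -/
theorem cellPoint_map {n m : ℕ} (G : ComposableArrows (Paths V) m) (hG : IsGood I G)
    {f : Fin (n + 1) → Fin (m + 1)} (hf : StrictMono f) (t : Simplex n) :
    cellPoint G hG (stdSimplex.map f t) =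
      cellPoint (G.whiskerLeft hf.monotone.functor) (hG.whiskerLeft hf) t := by
  induction m with
  | zero =>
    obtain rfl : n = 0 := by
      have := Fintype.card_le_of_injective f hf.injective
      simpa using this
    obtain rfl : f = id := funext fun j => Fin.ext (by have := (f j).2; simp only [id]; omega)
    rw [stdSimplex.map_id_apply]
    exact cellPoint_congr rfl _ _ _
  | succ m ih =>
    -- A surjective strictly monotone `f` is the identity. Otherwise `f` misses some vertex `i`,
    -- hence factors through the `i`-th face; one gluing relation then lowers `m`.
    by_cases hs : Function.Surjective f
    · obtain rfl : n = m + 1 := by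
        have := Fintype.card_of_bijective ⟨hf.injective, hs⟩
        simpa using this
      obtain rfl : f = id := by
        have := Subsingleton.elim (hf.orderIsoOfSurjective f hs) (OrderIso.refl _)
        funext i
        exact congrArg (fun e : Fin (m + 1 + 1) ≃o Fin (m + 1 + 1) => e i) this
      rw [stdSimplex.map_id_apply]
      exact cellPoint_congr rfl _ _ _
    · obtain ⟨i, hi⟩ : ∃ i, ∀ j, f j ≠ i := by
        simpa [Function.Surjective] using hs
      choose g hg using fun j => Fin.exists_succAbove_eq (hi j)
      have hgm : StrictMono g := fun a b hab =>
        (Fin.strictMono_succAbove i).lt_iff_lt.1 (by rw [hg, hg]; exact hf hab)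
      obtain rfl : i.succAbove ∘ g = f := funext hg
      rw [← stdSimplex.map_comp_apply]
      exact (cellPoint_faceIncl G hG i _).trans
        ((ih (G.whiskerLeft (skip i)) (hG.skip i) hgm).trans (cellPoint_congr rfl _ _ _))

/-- A continuous function on the simplices of all nonzero paths, compatible with the passage to
subpaths. -/
structure PathFamily (I : TwoSidedIdeal (PathAlgebra k V)) (X : Type*) [TopologicalSpace X] where
  /-- The function on the simplex of a nonzero path. -/
  fn : ∀ {x y : Paths V} (w : x ⟶ y), homElt k w ∉ I → Simplex (homLength w) → X
  continuous_fn : ∀ {x y : Paths V} (w : x ⟶ y) (h : homElt k w ∉ I), Continuous (fn w h)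
  fn_map : ∀ {x x' y' y : Paths V} (a : x ⟶ x') (w : x' ⟶ y') (b : y' ⟶ y)
    (h : homElt k (a ≫ w ≫ b) ∉ I) (h' : homElt k w ∉ I)
    (f : Fin (homLength w + 1) → Fin (homLength (a ≫ w ≫ b) + 1)),
    (∀ j, (f j : ℕ) = homLength a + j) → ∀ t, fn _ h (stdSimplex.map f t) = fn w h' t

namespace PathFamily

variable {X : Type*} [TopologicalSpace X] (K : PathFamily I X)

/-- The function of a path family on the simplex of a good sequence. -/
def onSeq {n : ℕ} (G : ComposableArrows (Paths V) n) (hG : IsGood I G) (t : Simplex n) : X :=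
  K.fn (total G) hG.total_notMem (stdSimplex.map (position G (𝟙 _) (𝟙 _) (id_total_id G)) t)

theorem onSeq_congr {n : ℕ} {G G' : ComposableArrows (Paths V) n} (h : G = G')
    (hG : IsGood I G) (hG' : IsGood I G') : K.onSeq G hG = K.onSeq G' hG' := by
  subst h; rfl

theorem fn_map' {x x' y' y : Paths V} {a : x ⟶ x'} {w' : x' ⟶ y'} {b : y' ⟶ y} {w : x ⟶ y}
    (e : w = a ≫ w' ≫ b) (h : homElt k w ∉ I) (h' : homElt k w' ∉ I)
    (f : Fin (homLength w' + 1) → Fin (homLength w + 1))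
    (hf : ∀ j, (f j : ℕ) = homLength a + j) (t) : K.fn w h (stdSimplex.map f t) = K.fn w' h' t := by
  subst e
  exact K.fn_map a w' b h h' f hf t

/-- Deleting a vertex replaces the total path by a subpath: the same path for an inner vertex, a
shorter one for an end vertex. Compatibility with subpaths treats all cases at once. -/
theorem onSeq_faceIncl {n : ℕ} (G : ComposableArrows (Paths V) (n + 1)) (hG : IsGood I G)
    (i : Fin (n + 2)) (t : Simplex n) :
    K.onSeq G hG (faceIncl i t) = K.onSeq (G.whiskerLeft (skip i)) (hG.skip i) t := by
  let G' : ComposableArrows (Paths V) n := G.whiskerLeft (skip i)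
  let a : G.obj 0 ⟶ G'.obj 0 := G.map (homOfLE (Fin.zero_le (i.succAbove 0)))
  let b : G'.obj (Fin.last n) ⟶ G.obj (Fin.last (n + 1)) :=
    G.map (homOfLE (Fin.le_last (i.succAbove (Fin.last n))))
  have e : total G = a ≫ total G' ≫ b :=
    (G.map_comp (homOfLE (Fin.zero_le (i.succAbove 0)))
      (homOfLE (Fin.le_last (i.succAbove 0)))).trans
      (congrArg (G.map (homOfLE (Fin.zero_le (i.succAbove 0))) ≫ ·)
        (G.map_comp
          (homOfLE ((Fin.strictMono_succAbove i).monotone (Fin.zero_le (Fin.last n))))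
          (homOfLE (Fin.le_last (i.succAbove (Fin.last n))))))
  have hl : homLength (total G) = homLength a + (homLength (total G') + homLength b) := by
    rw [e, homLength_comp, homLength_comp]
  let f : Fin (homLength (total G') + 1) → Fin (homLength (total G) + 1) := fun j =>
    ⟨homLength a + j, by omega⟩
  change _ = K.fn (total G') (hG.skip i).total_notMem _
  rw [← K.fn_map' e hG.total_notMem (hG.skip i).total_notMem f (fun _ => rfl), onSeq, faceIncl,
    stdSimplex.map_comp_apply, stdSimplex.map_comp_apply]
  congr 2
  funext j
  refine Fin.ext ?_
  -- A position in the long path is the offset `homLength a` plus the position in the subpath.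
  change homLength (upTo G (𝟙 _) (i.succAbove j)) = homLength a + homLength (upTo G' (𝟙 _) j)
  rw [← homLength_comp, upTo, upTo, Category.id_comp, Category.id_comp]
  exact congrArg homLength (G.map_comp (homOfLE (Fin.zero_le (i.succAbove 0)))
    (homOfLE ((Fin.strictMono_succAbove i).monotone (Fin.zero_le j))))

/-- The function of a path family on the disjoint union of the simplices. -/
def onSimplices (p : Simplices I) : X :=
  K.onSeq p.1.2.2.choose p.1.2.2.choose_spec.1 p.2

theorem onSimplices_cellOf (hI : IsMonomial I) {n : ℕ} (G : ComposableArrows (Paths V) n)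
    (hG : IsGood I G) (t : Simplex n) :
    K.onSimplices ⟨⟨n, cellOf G hG⟩, t⟩ = K.onSeq G hG t :=
  congrFun (K.onSeq_congr (hI.eq_of_comp_natClass (cellOf G hG).2.choose_spec.2) _ _) t

theorem onSimplices_glue (hI : IsMonomial I) (p q : Simplices I) (h : Glue I p q) :
    K.onSimplices p = K.onSimplices q := by
  obtain ⟨⟨_, G, hG, rfl⟩, i, t⟩ := h
  exact (K.onSimplices_cellOf hI G hG _).trans ((K.onSeq_faceIncl G hG i t).trans
    (K.onSimplices_cellOf hI _ (hG.skip i) t).symm)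

/-- The function on the classifying space defined by a path family. -/
def desc (hI : IsMonomial I) : ClassifyingSpace I → X :=
  Quot.lift K.onSimplices (K.onSimplices_glue hI)

theorem desc_cellPoint (hI : IsMonomial I) {n : ℕ} (G : ComposableArrows (Paths V) n)
    (hG : IsGood I G) (t : Simplex n) : K.desc hI (cellPoint G hG t) = K.onSeq G hG t :=
  K.onSimplices_cellOf hI G hG t

theorem continuous_desc (hI : IsMonomial I) : Continuous (K.desc hI) := by
  refine continuous_quot_lift _ (continuous_sigma fun c => ?_)
  exact (K.continuous_fn _ c.2.2.choose_spec.1.total_notMem).comp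
    (stdSimplex.continuous_map (position c.2.2.choose (𝟙 _) (𝟙 _) (id_total_id _)))

end PathFamily

end Descent

open PathAlgebra

/-! ### The left inverse of the graph map and the deformation -/

section Retraction

variable {k : Type w} {V : Type u} [Field k] [Quiver.{v + 1} V]

/-- The outer factors have length `0`; they bridge the chosen end vertices of the spine and the
actual endpoints `x`, `y`. -/
theorem total_spine {x y : Paths V} (w : x ⟶ y) :
    initial w 0 ≫ (spine w).map (homOfLE (Fin.zero_le (Fin.last _))) ≫ terminal w (Fin.last _) =
      w :=
  (Category.assoc _ _ _).symm.trans ((congrArg (· ≫ terminal w (Fin.last _))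
    (initial_comp_map w (homOfLE (Fin.zero_le (Fin.last _))))).trans
      (initial_comp_terminal w (Fin.last _)))

theorem exists_arrow_of_homLength_eq_one {x y : Paths V} (f : x ⟶ y) (hf : homLength f = 1) :
    ∃ a : Quiver.Hom (V := V) x y, f = (Paths.of V).map a := by
  obtain ⟨z, p, a, rfl⟩ := (Quiver.Path.length_ne_zero_iff_eq_cons (V := V) f).1
    (show homLength f ≠ 0 by omega)
  cases p with
  | nil => exact ⟨a, rfl⟩
  | cons p b => exact absurd hf (by change p.length + 1 + 1 ≠ 1; omega)

variable [Fintype V] {I : TwoSidedIdeal (PathAlgebra k V)}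

/-- The path family sending a point of the simplex of a path to the point of the path at the mean
position. -/
def meanFamily (I : TwoSidedIdeal (PathAlgebra k V)) : PathFamily I (UnderlyingGraph V) where
  fn w _ τ := homPoint w (mean τ)
  continuous_fn w _ := (continuous_pathPoint (V := V) w).comp continuous_mean
  fn_map a w b _ _ f hf t := by
    rw [mean_map_shift hf]
    exact homPoint_comp_comp a w b (mean_nonneg t) (mean_le t)

theorem isGood_spine {x y : Paths V} {w : x ⟶ y} (h : homElt k w ∉ I) : IsGood I (spine w) := by
  refine ⟨fun i => ?_, fun hs => h ?_⟩
  · have := homLength_spine_map w (homOfLE i.castSucc_le_succ)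
    simp only [Fin.val_castSucc, Fin.val_succ] at this
    omega
  · have e' := congrArg (homElt k) (total_spine w)
    refine e' ▸ ?_
    refine (homElt_comp (k := k) (initial w 0) _).symm ▸ I.mul_mem_left _ _ ?_
    exact (homElt_comp (k := k) ((spine w).map (homOfLE (Fin.zero_le (Fin.last _))))
      (terminal w (Fin.last _))).symm ▸ I.mul_mem_right _ _ hs

/-- Since `G` is a restriction of the spine of any nonzero path containing it, its simplex is glued
to the corresponding face. Thus every point of the classifying space lies in a spine simplex. -/
theorem cellPoint_spine_map {n : ℕ} (G : ComposableArrows (Paths V) n) (hG : IsGood I G)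
    {x y : Paths V} (a : x ⟶ G.obj 0) (b : G.obj (Fin.last n) ⟶ y) {w : x ⟶ y}
    (h : a ≫ G.map (homOfLE (Fin.zero_le (Fin.last n))) ≫ b = w) (hw : homElt k w ∉ I)
    (t : Simplex n) :
    cellPoint (spine w) (isGood_spine hw) (stdSimplex.map (position G a b h) t) =
      cellPoint G hG t :=
  (cellPoint_map _ _ (position_strictMono G a b h hG.1) t).trans
    (cellPoint_congr (whiskerLeft_spine G a b h) _ _ t)

theorem cellPoint_spine_shift {x x' y' y : Paths V} (a : x ⟶ x') (w : x' ⟶ y') (b : y' ⟶ y)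
    (h : homElt k (a ≫ w ≫ b) ∉ I) (h' : homElt k w ∉ I)
    (f : Fin (homLength w + 1) → Fin (homLength (a ≫ w ≫ b) + 1))
    (hf : ∀ j, (f j : ℕ) = homLength a + j) (t : Simplex (homLength w)) :
    cellPoint (spine (a ≫ w ≫ b)) (isGood_spine h) (stdSimplex.map f t) =
      cellPoint (spine w) (isGood_spine h') t := by
  have e : (a ≫ initial w 0) ≫ (spine w).map (homOfLE (Fin.zero_le (Fin.last _))) ≫
      (terminal w (Fin.last _) ≫ b) = a ≫ w ≫ b := by
    conv_rhs => rw [← total_spine w]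
    exact (Category.assoc _ _ _).trans (congrArg (a ≫ ·)
      ((congrArg (initial w 0 ≫ ·) (Category.assoc _ _ _).symm).trans (Category.assoc _ _ _).symm))
  -- The spine of `w` is itself a sequence inside `a ≫ w ≫ b`; what remains is that its `j`-th
  -- vertex sits at position `homLength a + j`.
  rw [← cellPoint_spine_map (spine w) (isGood_spine h') (a ≫ initial w 0)
    (terminal w (Fin.last _) ≫ b) e h t]
  congr 2
  funext j
  refine Fin.ext ((hf j).trans ?_)
  have h1 : upTo (spine w) (a ≫ initial w 0) j = a ≫ initial w j :=
    (Category.assoc _ _ _).trans (congrArg (a ≫ ·) (initial_comp_map w _))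
  change _ = homLength (upTo (spine w) (a ≫ initial w 0) j)
  rw [h1, ← homLength_initial w j]
  exact (homLength_comp _ _).symm

/-- The path family moving each point of the simplex of a path along the flow to the broken line
through the vertices. -/
def flowFamily (I : TwoSidedIdeal (PathAlgebra k V)) :
    PathFamily I C(unitInterval, ClassifyingSpace I) where
  -- Taking values in a space of paths lets the homotopy descend as a single map, so no product of a
  -- quotient map with the interval arises.
  fn w h := ContinuousMap.curry
    ⟨fun p : Simplex (homLength w) × unitInterval =>
      cellPoint (spine w) (isGood_spine h) (flow p.2 p.1),
      (continuous_cellPoint _ _).comp continuous_flow⟩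
  continuous_fn w h := ContinuousMap.continuous _
  fn_map a w b h h' f hf t := by
    ext s
    change cellPoint _ _ (flow s (stdSimplex.map f t)) = cellPoint _ _ (flow s t)
    rw [flow_map_shift hf]
    exact cellPoint_spine_shift a w b h h' f hf _

theorem flowFamily_desc_cellPoint (hI : IsMonomial I) {n : ℕ}
    (G : ComposableArrows (Paths V) n) (hG : IsGood I G) (t : Simplex n) (s : unitInterval) :
    (flowFamily I).desc hI (cellPoint G hG t) s =
      cellPoint (spine (total G)) (isGood_spine hG.total_notMem)
        (flow s (stdSimplex.map (position G (𝟙 _) (𝟙 _) (id_total_id G)) t)) :=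
  congrArg (fun f : C(unitInterval, ClassifyingSpace I) => f s)
    ((flowFamily I).desc_cellPoint hI G hG t)

theorem exists_cellPoint (b : ClassifyingSpace I) :
    ∃ (n : ℕ) (G : ComposableArrows (Paths V) n) (hG : IsGood I G) (t : Simplex n),
      cellPoint G hG t = b := by
  obtain ⟨⟨⟨n, _, G, hG, rfl⟩, t⟩, rfl⟩ := Quot.exists_rep b
  exact ⟨n, G, hG, t, rfl⟩

theorem flowFamily_desc_zero (hI : IsMonomial I) (b : ClassifyingSpace I) :
    (flowFamily I).desc hI b 0 = b := by
  obtain ⟨n, G, hG, t, rfl⟩ := exists_cellPoint b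
  rw [flowFamily_desc_cellPoint, flow_zero]
  exact cellPoint_spine_map G hG _ _ _ hG.total_notMem t

/-- The flow fixes the points of the cells of paths of length at most `1`. -/
theorem flowFamily_desc_of_length_le (hI : IsMonomial I) {n : ℕ}
    (G : ComposableArrows (Paths V) n) (hG : IsGood I G) (hl : homLength (total G) ≤ 1)
    (t : Simplex n) (s : unitInterval) :
    (flowFamily I).desc hI (cellPoint G hG t) s = cellPoint G hG t := by
  rw [flowFamily_desc_cellPoint, flow_eq_self hl]
  exact cellPoint_spine_map G hG _ _ _ hG.total_notMem t

theorem isGood_vertex (hI : IsAdmissible I) (x : V) :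
    IsGood I (ComposableArrows.mk₀ (C := Paths V) x) :=
  ⟨fun i => i.elim0, path_notMem hI (Quiver.Path.nil : Quiver.Path x x) Nat.zero_lt_two⟩

theorem isGood_arrow (hI : IsAdmissible I) {x y : V} (a : x ⟶ y) :
    IsGood I (ComposableArrows.mk₁ ((Paths.of V).map a)) :=
  ⟨fun i => by
    obtain rfl : i = 0 := Subsingleton.elim _ _
    exact one_ne_zero, path_notMem hI a.toPath Nat.one_lt_two⟩

theorem graphMap_vertex (hI : IsAdmissible I) (x : V) (t : Simplex 0) :
    graphMap hI (Quot.mk _ (Sum.inl ⟨x, t⟩)) =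
      cellPoint (ComposableArrows.mk₀ (C := Paths V) x) (isGood_vertex hI x) t := rfl

theorem graphMap_arrow (hI : IsAdmissible I) {x y : V} (a : x ⟶ y) (t : Simplex 1) :
    graphMap hI (Quot.mk _ (Sum.inr ⟨⟨x, y, a⟩, t⟩)) =
      cellPoint (ComposableArrows.mk₁ ((Paths.of V).map a)) (isGood_arrow hI a) t := rfl

theorem continuous_graphMap (hI : IsAdmissible I) : Continuous (graphMap hI) := by
  refine continuous_quot_lift _ (Continuous.sumElim ?_ ?_)
  · exact continuous_sigma fun x => continuous_cellPoint _ (isGood_vertex hI x)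
  · exact continuous_sigma fun a => continuous_cellPoint _ (isGood_arrow hI a.2.2)

theorem meanFamily_desc_graphMap (hI : IsAdmissible I) (hmon : IsMonomial I)
    (q : UnderlyingGraph V) : (meanFamily I).desc hmon (graphMap hI q) = q := by
  obtain ⟨⟨x, t⟩ | ⟨⟨x, y, a⟩, t⟩, rfl⟩ := Quot.exists_rep q
  · obtain rfl : t = default := Subsingleton.elim _ _
    rw [graphMap_vertex, PathFamily.desc_cellPoint]
    rfl
  · rw [graphMap_arrow, PathFamily.desc_cellPoint]
    set G := ComposableArrows.mk₁ ((Paths.of V).map a)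
    change pathPoint (Quiver.Path.nil.cons a)
      (mean (stdSimplex.map (position G (𝟙 _) (𝟙 _) (id_total_id G)) t)) = _
    -- The two vertices of an arrow sit at positions `0` and `1`, so the mean is the coordinate
    -- along the edge.
    have h : mean (stdSimplex.map (position G (𝟙 _) (𝟙 _) (id_total_id G)) t) = t 1 := by
      rw [mean_map, Fin.sum_univ_two]
      have h0 : (position G (𝟙 _) (𝟙 _) (id_total_id G) 0 : ℕ) = 0 := rfl
      have h1 : (position G (𝟙 _) (𝟙 _) (id_total_id G) 1 : ℕ) = 1 := rfl
      rw [h0, h1]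
      simp
    rw [h, pathPoint_cons_of_ge]
    · rw [Quiver.Path.length_nil, Nat.cast_zero, sub_zero, edgePoint, edgeCoord_eq]
    · exact (Nat.cast_zero (R := ℝ)).trans_le (t.2.1 1)

theorem isEmbedding_graphMap (hI : IsAdmissible I) (hmon : IsMonomial I) :
    IsEmbedding (graphMap hI) :=
  Function.LeftInverse.isEmbedding (meanFamily_desc_graphMap hI hmon)
    ((meanFamily I).continuous_desc hmon) (continuous_graphMap hI)

theorem flowFamily_desc_graphMap (hI : IsAdmissible I) (hmon : IsMonomial I)
    (q : UnderlyingGraph V) (s : unitInterval) :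
    (flowFamily I).desc hmon (graphMap hI q) s = graphMap hI q := by
  obtain ⟨⟨x, t⟩ | ⟨⟨x, y, a⟩, t⟩, rfl⟩ := Quot.exists_rep q
  · exact flowFamily_desc_of_length_le hmon _ (isGood_vertex hI x) (Nat.zero_le 1) t s
  · exact flowFamily_desc_of_length_le hmon _ (isGood_arrow hI a) (le_refl 1) t s

theorem cellPoint_mem_range_of_eq_zero (hI : IsAdmissible I) {n : ℕ} (hn : n = 0)
    (G : ComposableArrows (Paths V) n) (hG : IsGood I G) (t : Simplex n) :
    cellPoint G hG t ∈ Set.range (graphMap hI) := by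
  subst hn
  obtain ⟨x, rfl⟩ := ComposableArrows.mk₀_surjective G
  exact ⟨Quot.mk _ (Sum.inl ⟨x, t⟩), rfl⟩

theorem cellPoint_mem_range_of_length_eq_one (hI : IsAdmissible I)
    (G : ComposableArrows (Paths V) 1) (hG : IsGood I G) (hl : homLength (total G) = 1)
    (t : Simplex 1) : cellPoint G hG t ∈ Set.range (graphMap hI) := by
  obtain ⟨x, y, f, rfl⟩ := ComposableArrows.mk₁_surjective G
  obtain ⟨a, rfl⟩ := exists_arrow_of_homLength_eq_one f hl
  exact ⟨Quot.mk _ (Sum.inr ⟨⟨x, y, a⟩, t⟩), rfl⟩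

/-- The flow ends on an edge between consecutive vertices of a spine. The piece of path between them
has length `1`, so it is an arrow; a stationary total path gives a vertex. -/
theorem flowFamily_desc_one (hI : IsAdmissible I) (hmon : IsMonomial I)
    (b : ClassifyingSpace I) :
    (flowFamily I).desc hmon b 1 ∈ Set.range (graphMap hI) := by
  obtain ⟨n, G, hG, t, rfl⟩ := exists_cellPoint b
  rw [flowFamily_desc_cellPoint]
  by_cases hm : homLength (total G) = 0
  · exact cellPoint_mem_range_of_eq_zero hI hm _ _ _
  · obtain ⟨i, f, t', h0, h1, e⟩ := exists_flow_one_eq hm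
      (stdSimplex.map (position G (𝟙 _) (𝟙 _) (id_total_id G)) t)
    have hf : StrictMono f := by
      refine Fin.strictMono_iff_lt_succ.2 fun j => ?_
      obtain rfl : j = 0 := Subsingleton.elim _ _
      change (f 0 : ℕ) < f 1
      omega
    rw [e, cellPoint_map _ _ hf]
    refine cellPoint_mem_range_of_length_eq_one hI _ _ ?_ _
    have h : (f 0 : ℕ) + homLength (total ((spine (total G)).whiskerLeft hf.monotone.functor)) =
        f 1 := homLength_spine_map (total G) (homOfLE (hf.monotone (Fin.zero_le 1)))
    omega

theorem isStrongDeformationRetract_range_graphMap (hI : IsAdmissible I) (hmon : IsMonomial I) :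
    IsStrongDeformationRetract (Set.range (graphMap hI)) := by
  let Φ : C(ClassifyingSpace I, C(unitInterval, ClassifyingSpace I)) :=
    ⟨(flowFamily I).desc hmon, (flowFamily I).continuous_desc hmon⟩
  have hc : Continuous fun p : unitInterval × ClassifyingSpace I => Φ p.2 p.1 :=
    -- Local compactness of the unit interval turns continuity into the path space into joint
    -- continuity.
    (ContinuousMap.continuous_uncurry_of_continuous Φ).comp continuous_swap
  refine ⟨⟨fun b => Φ b 1, hc.comp (continuous_const.prodMk continuous_id)⟩,
    flowFamily_desc_one hI hmon, ⟨{
      toFun := fun p => Φ p.2 p.1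
      continuous_toFun := hc
      map_zero_left := flowFamily_desc_zero hmon
      map_one_left := fun _ => rfl
      prop' := ?_ }⟩⟩
  rintro s _ ⟨q, rfl⟩
  exact flowFamily_desc_graphMap hI hmon q s

end Retraction

end BoundQuiver

end

/-- Let `(Q, I)` be a bound quiver with `I` monomial and `kQ / I` almost triangular. The canonical
map from the underlying graph of `Q` to the classifying space `B(Q, I)` is an embedding, and its
image is a strong deformation retract of `B(Q, I)`. -/
theorem proposition3p1 {k : Type w} [Field k] {V : Type u} [Quiver.{v + 1} V] [Fintype V]
    [∀ x y : V, Finite (x ⟶ y)] (I : TwoSidedIdeal (PathAlgebra k V))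
    (hI : BoundQuiver.IsAdmissible I) (hmon : BoundQuiver.IsMonomial I)
    (htri : BoundQuiver.IsAlmostTriangular I) :
    Topology.IsEmbedding (BoundQuiver.graphMap hI) ∧
      IsStrongDeformationRetract (Set.range (BoundQuiver.graphMap hI)) :=
  ⟨BoundQuiver.isEmbedding_graphMap hI hmon,
    BoundQuiver.isStrongDeformationRetract_range_graphMap hI hmon⟩
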